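/- **Bidirectional scheduling.** An instance consists of segments $M=\{1,\dots,m\}$, ordered from left to right, and a finite set $J$ of $n$ jobs, each rightbound or leftbound. Job $j$ has a release date $r_j\in\mathbb N=\{0,1,2,\dots\}$, a processing time $p_j\in\mathbb N$, a start segment $s_j$ and a target segment $t_j$, with $s_j\le t_j$ if $j$ is rightbound and $s_j\ge t_j$ if $j$ is leftbound; it has to cross the set $M_j$ of all segments between $s_j$ and $t_j$ (inclusive), in the order from $s_j$ to $t_j$. Segment $i$ has a transit time $\tau_i\in\mathbb N$ and a bipartite compatibility graph $G_i$ with edge set $E_i$, each of whose edges joins a rightbound and a leftbound job. A schedule fixes real start times $S_{ij}$ for each job $j$ and each $i\in M_j$; put $C_{ij}=S_{ij}+p_j+\tau_i$ and $C_j=C_{t_jj}$. It is feasible if 1. $r_j\le S_{s_jj}$ for every job $j$; 2. $C_{ij}\le S_{i+1,j}$ (for rightbound $j$), respectively $C_{ij}\le S_{i-1,j}$ (for leftbound $j$), for $i\in M_j\setminus\{t_j\}$; 3. $[S_{ij},S_{ij}+p_j)\cap[S_{ij'},S_{ij'}+p_{j'})=\emptyset$ for any two distinct jobs $j,j'$ of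 the same direction and $i\in M_j\cap M_{j'}$; 4. $[S_{ij},C_{ij})\cap[S_{ij'},C_{ij'})=\emptyset$ for any two jobs $j,j'$ of different directions and $i\in M_j\cap M_{j'}$ with $\{j,j'\}\notin E_i$. The task is to compute a feasible schedule that minimizes the total completion time $\sum_{j\in J}C_j$. Two jobs of the same direction have the same compatibility type if, for each segment $i$, they have the same set of neighbours in $G_i$. **Theorem 6.** Let $m$, $\kappa$ and $T$ be constants. The bidirectional scheduling problem can be solved in time polynomial in the binary length of the instance (by an algorithm and with a polynomial that may depend on $m$, $\kappa$, $T$), when restricted to the instances with $m$ segments and at most $\kappa$ different compatibility types that satisfy (a) $p_j=1$ for every job $j$ and $\tau_i\le T$ for every segment $i$; or (b) $p_j=0$ for every job $j$ and $\tau_i=1$ for every segment $i$. -/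

import Mathlib

namespace BidirScheduling

/-! ### Random access machines with a step count -/

/-- A memory configuration: the program addresses finitely many memories `0, 1, 2, …`, each a
sequence of cells that hold natural numbers. `σ a i` is the content of cell `i` of memory `a`. -/
abbrev Store := ℕ → ℕ → ℕ

/-- Expressions of the machine: constants, indirect reads, addition and truncated subtraction.
There is no multiplication, so a command lengthens numbers by at most a constant number of bits,
and counting commands (unit cost) is polynomially equivalent to counting steps of a Turing
machine. -/
inductive Expr where
  /-- a constant -/
  | lit (k : ℕ) : Expr
  /-- the content of the cell of memory `a` whose address is the value of `e` -/
  | get (a : ℕ) (e : Expr) : Expr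
  /-- sum -/
  | add (e₁ e₂ : Expr) : Expr
  /-- truncated difference -/
  | sub (e₁ e₂ : Expr) : Expr

/-- The value of an expression. -/
def Expr.eval (σ : Store) : Expr → ℕ
  | .lit k => k
  | .get a e => σ a (e.eval σ)
  | .add e₁ e₂ => e₁.eval σ + e₂.eval σ
  | .sub e₁ e₂ => e₁.eval σ - e₂.eval σ

/-- The cost of evaluating an expression: its number of operations. -/
def Expr.cost : Expr → ℕ
  | .lit _ => 1
  | .get _ e => e.cost + 1
  | .add e₁ e₂ => e₁.cost + e₂.cost + 1
  | .sub e₁ e₂ => e₁.cost + e₂.cost + 1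

/-- Programs of the machine. -/
inductive Prog where
  /-- do nothing -/
  | skip : Prog
  /-- write the value of `e` into the cell of memory `a` whose address is the value of `idx` -/
  | set (a : ℕ) (idx e : Expr) : Prog
  /-- sequential composition -/
  | seq (c d : Prog) : Prog
  /-- run `c` if the value of `e` is nonzero and `d` otherwise -/
  | ite (e : Expr) (c d : Prog) : Prog
  /-- repeat `c` as long as the value of `e` is nonzero -/
  | loop (e : Expr) (c : Prog) : Prog

/-- `σ.write a i v` is `σ` with the content of cell `i` of memory `a` replaced by `v`. -/
def Store.write (σ : Store) (a i v : ℕ) : Store :=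
  fun b k => if b = a ∧ k = i then v else σ b k

/-- `Exec c σ t σ'`: started in `σ`, the program `c` halts after exactly `t` steps in `σ'`. -/
inductive Exec : Prog → Store → ℕ → Store → Prop where
  | skip (σ : Store) : Exec .skip σ 1 σ
  | set (a : ℕ) (idx e : Expr) (σ : Store) :
      Exec (.set a idx e) σ (idx.cost + e.cost + 1) (σ.write a (idx.eval σ) (e.eval σ))
  | seq {c d : Prog} {σ σ' σ'' : Store} {t u : ℕ} :
      Exec c σ t σ' → Exec d σ' u σ'' → Exec (.seq c d) σ (t + u) σ''
  | ite_true {e : Expr} {c d : Prog} {σ σ' : Store} {t : ℕ} :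
      e.eval σ ≠ 0 → Exec c σ t σ' → Exec (.ite e c d) σ (e.cost + t + 1) σ'
  | ite_false {e : Expr} {c d : Prog} {σ σ' : Store} {t : ℕ} :
      e.eval σ = 0 → Exec d σ t σ' → Exec (.ite e c d) σ (e.cost + t + 1) σ'
  | loop_true {e : Expr} {c : Prog} {σ σ' σ'' : Store} {t u : ℕ} :
      e.eval σ ≠ 0 → Exec c σ t σ' → Exec (.loop e c) σ' u σ'' →
      Exec (.loop e c) σ (e.cost + t + u + 1) σ''
  | loop_false {e : Expr} {c : Prog} {σ : Store} :
      e.eval σ = 0 → Exec (.loop e c) σ (e.cost + 1) σ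

/-- The initial store on input `x`: memory `0` holds `x`, all other cells hold `0`. -/
def initStore (x : List ℕ) : Store :=
  fun a i => if a = 0 then x.getD i 0 else 0

/-- The length of the binary encoding of a list of natural numbers, counting one separator per
entry. -/
def bitSize (x : List ℕ) : ℕ :=
  (x.map fun k => k.size + 1).sum

/-- A search problem on instances of type `α` that satisfy the promise `P`, given to the machine
through the encoding `enc`, is solvable in polynomial time: one program halts on every such
instance within a number of steps that is bounded by a polynomial in the binary length of the
input, and the content of memory `1` is then a solution. -/
def SolvableInPolyTime {α : Type} (enc : α → List ℕ) (P : α → Prop)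
    (IsSolution : α → (ℕ → ℕ) → Prop) : Prop :=
  ∃ (c : Prog) (q : Polynomial ℕ), ∀ x : α, P x →
    ∃ (t : ℕ) (σ : Store), Exec c (initStore (enc x)) t σ ∧
      t ≤ q.eval (bitSize (enc x)) ∧ IsSolution x (σ 1)

/-! ### Bidirectional scheduling -/

/-- An instance of the bidirectional scheduling problem with compatibility graphs. Segments are
numbered from left to right. -/
structure Instance where
  /-- number of segments -/
  m : ℕ
  /-- number of jobs -/
  n : ℕ
  /-- is the job rightbound (otherwise it is leftbound)? -/
  right : Fin n → Bool
  /-- release dates -/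
  release : Fin n → ℕ
  /-- start segments -/
  start : Fin n → Fin m
  /-- target segments -/
  target : Fin n → Fin m
  /-- processing times -/
  proc : Fin n → ℕ
  /-- transit times -/
  transit : Fin m → ℕ
  /-- the compatibility graph of each segment -/
  compat : Fin m → SimpleGraph (Fin n)
  start_le_target : ∀ j, right j = true → start j ≤ target j
  target_le_start : ∀ j, right j = false → target j ≤ start j
  bipartite : ∀ i, (compat i).IsBipartiteWith {j | right j = true} {j | right j = false}

namespace Instance

variable (I : Instance)

/-- The segments that job `j` needs to cross: all those from its start to its target. -/
def segments (j : Fin I.n) : Set (Fin I.m) :=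
  Set.uIcc (I.start j) (I.target j)

/-- A schedule: `S j i` is the start time of job `j` on segment `i`. Only the values with
`i ∈ I.segments j` matter. -/
abbrev Schedule := Fin I.n → Fin I.m → ℝ

variable {I}

/-- The completion time of job `j` on segment `i`. -/
def Schedule.completion (S : I.Schedule) (j : Fin I.n) (i : Fin I.m) : ℝ :=
  S j i + I.proc j + I.transit i

/-- Feasibility of a schedule. -/
structure Schedule.Feasible (S : I.Schedule) : Prop where
  release_le : ∀ j, (I.release j : ℝ) ≤ S j (I.start j)
  travel_right : ∀ j, I.right j = true → ∀ i ∈ I.segments j, ∀ i' ∈ I.segments j,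
    (i' : ℕ) = i + 1 → S.completion j i ≤ S j i'
  travel_left : ∀ j, I.right j = false → ∀ i ∈ I.segments j, ∀ i' ∈ I.segments j,
    (i : ℕ) = i' + 1 → S.completion j i ≤ S j i'
  same_direction : ∀ j j', j ≠ j' → I.right j = I.right j' →
    ∀ i ∈ I.segments j ∩ I.segments j',
      Disjoint (Set.Ico (S j i) (S j i + I.proc j)) (Set.Ico (S j' i) (S j' i + I.proc j'))
  opposite_direction : ∀ j j', I.right j ≠ I.right j' →
    ∀ i ∈ I.segments j ∩ I.segments j', ¬ (I.compat i).Adj j j' →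
      Disjoint (Set.Ico (S j i) (S.completion j i)) (Set.Ico (S j' i) (S.completion j' i))

/-- The total completion time of a schedule. -/
def Schedule.totalCompletion (S : I.Schedule) : ℝ :=
  ∑ j, S.completion j (I.target j)

/-- A feasible schedule of minimum total completion time. -/
def Schedule.IsOptimal (S : I.Schedule) : Prop :=
  S.Feasible ∧ ∀ S' : I.Schedule, S'.Feasible → S.totalCompletion ≤ S'.totalCompletion

variable (I)

/-- The compatibility type of a job: its direction together with the set of jobs compatible with
it on each segment. -/
def compatType (j : Fin I.n) : Bool × (Fin I.m → Set (Fin I.n)) :=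
  (I.right j, fun i => (I.compat i).neighborSet j)

/-- The number of different compatibility types of the jobs. -/
noncomputable def numTypes : ℕ :=
  (Set.range I.compatType).ncard

open Classical in
/-- The encoding of an instance as a list of numbers: `m`, `n`, the transit times, for each job its
direction, release date, start, target and processing time, and the adjacency matrices of the
compatibility graphs. -/
noncomputable def encode : List ℕ :=
  [I.m, I.n] ++ List.ofFn I.transit ++
    (List.ofFn fun j => [if I.right j = true then 1 else 0, I.release j, (I.start j : ℕ),
      (I.target j : ℕ), I.proc j]).flatten ++
    (List.ofFn fun i => (List.ofFn fun j => List.ofFn fun j' =>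
      if (I.compat i).Adj j j' then 1 else 0).flatten).flatten

/-- The schedule described by a sequence of numbers: the start times of job `0` on the segments
`0, …, m - 1`, then those of job `1`, and so on. -/
def decodeSchedule (out : ℕ → ℕ) : I.Schedule :=
  fun j i => (out (j * I.m + i) : ℝ)

end Instance

/-- Bidirectional scheduling, restricted to the instances that satisfy `P`, can be solved in
polynomial time: a schedule of minimum total completion time (among all schedules with real start
times) can be computed. -/
def PolyTimeOn (P : Instance → Prop) : Prop :=
  SolvableInPolyTime Instance.encode P fun I out => (I.decodeSchedule out).IsOptimal

end BidirScheduling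

/-! Both cases are instances of `Restricted`: all jobs have the same processing time `p`, and `p`
plus any transit time lies between `1` and a constant `L` (`p = 1`, `L = T + 1`, or `p = 0`, `L =
1`). Every constraint between two start times therefore demands an integral distance of at most `L`,
and the cost is the sum of the start times on the target segments, up to a constant.

Rounding all start times down preserves such constraints (`Schedule.Feasible.exists_timetable`), so
integral start times suffice. Moving them to earlier times as long as possible makes every start
time a release date, or puts it at most `L` behind another start time (`exists_tight`); hence it
lies at most `n * m * L` after some release date. Although release dates may be exponentially large,
only polynomially many points in time matter: the slots.

Jobs with equal direction, start, target and neighbours differ in their release dates only, and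
there are at most `κ * m * m` such classes. A dynamic program runs through the slots. Its state
records, for each class, each segment and each `k ≤ L`, how many jobs of the class were started
there at least `k` slots ago. For constant `m`, `κ`, `L` these are polynomially many states. A
timetable yields a valid sequence of states of the same cost (`exists_states_of_timetable`).
Conversely, a valid sequence yields a timetable of the same cost by starting the jobs of each class
in the order of their release dates on every segment (`timetable_of_states`).

That all this runs in polynomial time is shown by closure properties of `Cpt`: a definition built
from additions, truncated subtractions, case distinctions and bounded recursion can be compiled into
a program. The loop bounds are polynomial in the number of jobs alone. -/

namespace BidirScheduling

/-! ### Evaluating functions in polynomial time -/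

/-- `Cpt inp N w f`: with memory `0` holding the input `inp x` and cell `0` of memory `2` holding
`N x`, the value `f x σ`, which depends only on the memories `3, …, w - 1`, can be computed in time
polynomial in `N x`. The program can be chosen to use only memories from any base `b ≥ w` on, and
to leave the value in cell `0` of memory `b`. -/
def Cpt {ι : Type} (inp : ι → ℕ → ℕ) (N : ι → ℕ) (w : ℕ) (f : ι → Store → ℕ) : Prop :=
  (∀ x σ σ', (∀ a, 3 ≤ a → a < w → σ a = σ' a) → f x σ = f x σ') ∧
  ∀ b, w ≤ b → 3 ≤ b → ∃ (c : Prog) (q : Polynomial ℕ), ∀ x σ, σ 0 = inp x → σ 2 0 = N x →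
    ∃ t σ', Exec c σ t σ' ∧ t ≤ q.eval (N x) ∧ (∀ a < b, σ' a = σ a) ∧ σ' b 0 = f x σ

open Classical in
/-- The decision version of `Cpt`. -/
def CptP {ι : Type} (inp : ι → ℕ → ℕ) (N : ι → ℕ) (w : ℕ) (p : ι → Store → Prop) : Prop :=
  Cpt inp N w fun x σ => if p x σ then 1 else 0

/-- `A` can be evaluated at every argument that can be computed. -/
def CptFun {ι : Type} (inp : ι → ℕ → ℕ) (N : ι → ℕ) (w : ℕ) (A : ι → Store → ℕ → ℕ) : Prop :=
  ∀ w' ≥ w, ∀ e, Cpt inp N w' e → Cpt inp N w' fun x σ => A x σ (e x σ)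

theorem Store.write_same (σ : Store) (a i v : ℕ) : σ.write a i v a i = v := by
  simp [Store.write]

theorem Store.write_ne (σ : Store) {a b : ℕ} (i v : ℕ) (h : b ≠ a) : σ.write a i v b = σ b := by
  funext k; simp [Store.write, h]

theorem Store.write_ne_idx (σ : Store) (a : ℕ) {i k : ℕ} (v : ℕ) (h : k ≠ i) :
    σ.write a i v a k = σ a k := by
  simp [Store.write, h]

/-- The values of the first cells of a table filled by course-of-values recursion. -/
def tabRec (g : ℕ → (ℕ → ℕ) → ℕ) : ℕ → ℕ → ℕ
  | 0 => fun _ => 0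
  | k + 1 => Function.update (tabRec g k) k (g k (tabRec g k))

theorem tabRec_of_le (g : ℕ → (ℕ → ℕ) → ℕ) {k y : ℕ} (h : k ≤ y) : tabRec g k y = 0 := by
  induction k with
  | zero => rfl
  | succ k ih =>
    rw [tabRec, Function.update_of_ne (by omega)]
    exact ih (by omega)

theorem tabRec_of_lt (g : ℕ → (ℕ → ℕ) → ℕ) {k y : ℕ} (h : y < k) :
    tabRec g k y = g y (tabRec g y) := by
  induction k with
  | zero => omega
  | succ k ih =>
    rw [tabRec]
    rcases eq_or_ne y k with rfl | hne
    · simp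
    · rw [Function.update_of_ne hne]
      exact ih (by omega)

/-- Iteration of a function that also sees the number of the round. -/
def iterN (a : ℕ) (g : ℕ → ℕ → ℕ) : ℕ → ℕ
  | 0 => a
  | k + 1 => g k (iterN a g k)

theorem tabRec_eq_iterN (a : ℕ) (g : ℕ → ℕ → ℕ) (b : ℕ) :
    tabRec (fun k A => if k = 0 then a else g (k - 1) (A (k - 1))) (b + 1) b = iterN a g b := by
  rw [tabRec_of_lt _ (Nat.lt_succ_self b)]
  induction b with
  | zero => rfl
  | succ b ih =>
    simp only [Nat.add_one_ne_zero, if_false, Nat.add_sub_cancel, iterN]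
    rw [tabRec_of_lt _ (Nat.lt_succ_self b), ih]

/-- Run `body` for the values of cell `0` of memory `k` below that of cell `0` of memory `lim`. -/
def forLoop (k lim : ℕ) (body : Prog) : Prog :=
  .loop (.sub (.get lim (.lit 0)) (.get k (.lit 0)))
    (.seq body (.set k (.lit 0) (.add (.get k (.lit 0)) (.lit 1))))

/-- `d` is the number of rounds still to run. The invariant refers to the store after the increment
of the counter; test and increment cost 12 steps per round. -/
theorem exec_forLoop {kk lim B τ : ℕ} {body : Prog} {Inv : ℕ → Store → Prop}
    (hlim : ∀ k σ, Inv k σ → σ lim 0 = B ∧ σ kk 0 = k)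
    (hbody : ∀ k < B, ∀ σ, Inv k σ → ∃ t σ', Exec body σ t σ' ∧ t ≤ τ ∧ σ' kk 0 = k ∧
      Inv (k + 1) (σ'.write kk 0 (k + 1))) (d : ℕ) :
    ∀ k σ, k + d = B → Inv k σ →
      ∃ t σ', Exec (forLoop kk lim body) σ t σ' ∧ t ≤ d * (τ + 12) + 12 ∧ Inv B σ' := by
  induction d with
  | zero =>
    intro k σ hk hI
    obtain ⟨h1, h2⟩ := hlim k σ hI
    refine ⟨_, σ, Exec.loop_false ?_, ?_, ?_⟩
    · simp [Expr.eval, h1, h2]; omega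
    · simp [Expr.cost]
    · rwa [← hk]
  | succ d ih =>
    intro k σ hk hI
    obtain ⟨h1, h2⟩ := hlim k σ hI
    obtain ⟨t, σ', he, ht, hk', hI'⟩ := hbody k (by omega) σ hI
    obtain ⟨u, σ'', he', hu, hI''⟩ := ih (k + 1) _ (by omega) hI'
    have hset := Exec.set kk (.lit 0) (.add (.get kk (.lit 0)) (.lit 1)) σ'
    simp only [Expr.eval, hk'] at hset
    refine ⟨_, σ'', Exec.loop_true ?_ (Exec.seq he hset) he', ?_, hI''⟩
    · simp [Expr.eval, h1, h2]; omega
    · simp [Expr.cost]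
      nlinarith

/-! ### Closure properties of computable functions. -/

namespace Cpt

variable {ι : Type} {inp : ι → ℕ → ℕ} {N : ι → ℕ} {w : ℕ} {f g h : ι → Store → ℕ}
  {p r : ι → Store → Prop}

theorem mono {w' : ℕ} (hf : Cpt inp N w f) (h : w ≤ w') : Cpt inp N w' f :=
  ⟨fun x σ σ' hs => hf.1 x σ σ' fun a h3 ha => hs a h3 (by omega),
    fun b hb h3 => hf.2 b (by omega) h3⟩

theorem lit (k : ℕ) : Cpt inp N w fun _ _ => k := by
  refine ⟨fun _ _ _ _ => rfl, fun b _ _ => ⟨.set b (.lit 0) (.lit k), .C 3, fun x σ _ _ =>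
    ⟨_, _, Exec.set _ _ _ _, by simp [Expr.cost], fun a ha => Store.write_ne _ _ _ (by omega), ?_⟩⟩⟩
  exact Store.write_same _ _ _ _

theorem get {a : ℕ} (ha : 3 ≤ a) (haw : a < w) (hf : Cpt inp N w f) :
    Cpt inp N w fun x σ => σ a (f x σ) := by
  refine ⟨fun x σ σ' hs => by beta_reduce; rw [hf.1 x σ σ' hs, hs a ha haw], fun b hb h3 => ?_⟩
  obtain ⟨c, q, hc⟩ := hf.2 b hb h3
  refine ⟨.seq c (.set b (.lit 0) (.get a (.get b (.lit 0)))), q + .C 10, fun x σ h0 h2 => ?_⟩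
  obtain ⟨t, σ', he, ht, hs, hv⟩ := hc x σ h0 h2
  refine ⟨_, _, Exec.seq he (Exec.set _ _ _ _), ?_, fun a' ha' => ?_, ?_⟩
  · simp [Expr.cost]; omega
  · rw [Store.write_ne _ _ _ (by omega), hs a' ha']
  · simp only [Expr.eval]
    rw [Store.write_same, hv, hs a (by omega)]

theorem cell {a : ℕ} (ha : 3 ≤ a) (haw : a < w) : Cpt inp N w fun _ σ => σ a 0 :=
  get ha haw (lit 0)

theorem input (hf : Cpt inp N w f) : Cpt inp N w fun x σ => inp x (f x σ) := by
  refine ⟨fun x σ σ' hs => by beta_reduce; rw [hf.1 x σ σ' hs], fun b hb h3 => ?_⟩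
  obtain ⟨c, q, hc⟩ := hf.2 b hb h3
  refine ⟨.seq c (.set b (.lit 0) (.get 0 (.get b (.lit 0)))), q + .C 10, fun x σ h0 h2 => ?_⟩
  obtain ⟨t, σ', he, ht, hs, hv⟩ := hc x σ h0 h2
  refine ⟨_, _, Exec.seq he (Exec.set _ _ _ _), ?_, fun a' ha' => ?_, ?_⟩
  · simp [Expr.cost]; omega
  · rw [Store.write_ne _ _ _ (by omega), hs a' ha']
  · simp only [Expr.eval]
    rw [Store.write_same, hv, hs 0 (by omega), h0]

theorem congr (hf : Cpt inp N w f) (h : ∀ x σ, g x σ = f x σ) : Cpt inp N w g := by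
  rwa [show g = f from funext fun x => funext fun σ => h x σ]

/-- Evaluate two functions and combine their values by one expression. -/
theorem binary (op : ℕ → ℕ → ℕ) (hop : ∃ E : Expr → Expr → Expr,
      (∀ σ e₁ e₂, (E e₁ e₂).eval σ = op (e₁.eval σ) (e₂.eval σ)) ∧
      ∀ e₁ e₂, (E e₁ e₂).cost = e₁.cost + e₂.cost + 1)
    (hf : Cpt inp N w f) (hg : Cpt inp N w g) : Cpt inp N w fun x σ => op (f x σ) (g x σ) := by
  refine ⟨fun x σ σ' hs => by beta_reduce; rw [hf.1 x σ σ' hs, hg.1 x σ σ' hs], fun b hb h3 => ?_⟩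
  obtain ⟨E, hE, hEc⟩ := hop
  obtain ⟨c, q, hc⟩ := hf.2 b hb h3
  -- The second program works from base `b + 1` on and thus preserves the first value in memory `b`.
  obtain ⟨c', q', hc'⟩ := hg.2 (b + 1) (by omega) (by omega)
  refine ⟨.seq c (.seq c' (.set b (.lit 0) (E (.get b (.lit 0)) (.get (b + 1) (.lit 0))))),
    q + q' + .C 10, fun x σ h0 h2 => ?_⟩
  obtain ⟨t, σ', he, ht, hs, hv⟩ := hc x σ h0 h2
  obtain ⟨u, σ'', he', hu, hs', hv'⟩ := hc' x σ' (by rw [hs 0 (by omega), h0])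
    (by rw [hs 2 (by omega), h2])
  refine ⟨_, _, Exec.seq he (Exec.seq he' (Exec.set _ _ _ _)), ?_, fun a' ha' => ?_, ?_⟩
  · simp [Expr.cost, hEc]; omega
  · rw [Store.write_ne _ _ _ (by omega), hs' a' (by omega), hs a' ha']
  · rw [hE]
    simp only [Expr.eval]
    rw [Store.write_same, hv', hs' b (by omega), hv, hg.1 x σ' σ fun a _ ha => hs a (by omega)]

theorem add (hf : Cpt inp N w f) (hg : Cpt inp N w g) : Cpt inp N w fun x σ => f x σ + g x σ :=
  binary (· + ·) ⟨.add, fun _ _ _ => rfl, fun _ _ => rfl⟩ hf hg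

theorem sub (hf : Cpt inp N w f) (hg : Cpt inp N w g) : Cpt inp N w fun x σ => f x σ - g x σ :=
  binary (· - ·) ⟨.sub, fun _ _ _ => rfl, fun _ _ => rfl⟩ hf hg

theorem ite_zero (hf : Cpt inp N w f) (hg : Cpt inp N w g) (hh : Cpt inp N w h) :
    Cpt inp N w fun x σ => if f x σ = 0 then g x σ else h x σ := by
  refine ⟨fun x σ σ' hs => by beta_reduce; rw [hf.1 x σ σ' hs, hg.1 x σ σ' hs, hh.1 x σ σ' hs],
    fun b hb h3 => ?_⟩
  obtain ⟨c, q, hc⟩ := hf.2 b hb h3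
  obtain ⟨c₁, q₁, hc₁⟩ := hg.2 b hb h3
  obtain ⟨c₂, q₂, hc₂⟩ := hh.2 b hb h3
  refine ⟨.seq c (.ite (.get b (.lit 0)) c₂ c₁), q + q₁ + q₂ + .C 10, fun x σ h0 h2 => ?_⟩
  obtain ⟨t, σ', he, ht, hs, hv⟩ := hc x σ h0 h2
  have h0' : σ' 0 = inp x := by rw [hs 0 (by omega), h0]
  have h2' : σ' 2 0 = N x := by rw [hs 2 (by omega), h2]
  by_cases hz : f x σ = 0
  · obtain ⟨u, σ'', he', hu, hs', hv'⟩ := hc₁ x σ' h0' h2'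
    refine ⟨_, _, Exec.seq he (Exec.ite_false (by simp [Expr.eval, hv, hz]) he'), ?_,
      fun a' ha' => by rw [hs' a' ha', hs a' ha'], ?_⟩
    · simp [Expr.cost]; omega
    · beta_reduce; rw [hv', if_pos hz, hg.1 x σ' σ fun a _ ha => hs a (by omega)]
  · obtain ⟨u, σ'', he', hu, hs', hv'⟩ := hc₂ x σ' h0' h2'
    refine ⟨_, _, Exec.seq he (Exec.ite_true (by simp [Expr.eval, hv, hz]) he'), ?_,
      fun a' ha' => by rw [hs' a' ha', hs a' ha'], ?_⟩
    · simp [Expr.cost]; omega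
    · beta_reduce; rw [hv', if_neg hz, hh.1 x σ' σ fun a _ ha => hs a (by omega)]

theorem ite {dec : ∀ x σ, Decidable (p x σ)} (hp : CptP inp N w p) (hg : Cpt inp N w g)
    (hh : Cpt inp N w h) : Cpt inp N w fun x σ => if p x σ then g x σ else h x σ :=
  (ite_zero hp hh hg).congr fun x σ => by by_cases h : p x σ <;> simp [h]

/-- The one loop from which iterations, sums, searches, minima and the table of the dynamic program
are derived. Memory `β` holds the argument, `β + 1` the length of the table, `β + 2` the counter, `β
+ 3` the table, and the body works from `β + 4` on. -/
theorem tab {b e : ι → Store → ℕ} {G : ι → Store → ℕ → (ℕ → ℕ) → ℕ}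
    (hb : Cpt inp N w b) (hbN : ∀ x σ, b x σ ≤ N x + 1)
    (hGd : ∀ x σ σ', (∀ a, 3 ≤ a → a < w → σ a = σ' a) → G x σ = G x σ')
    (hG : ∀ w' ≥ w, ∀ z A, Cpt inp N w' z → CptFun inp N w' A →
      Cpt inp N w' fun x σ => G x σ (z x σ) (A x σ))
    (he : Cpt inp N w e) : Cpt inp N w fun x σ => tabRec (G x σ) (b x σ) (e x σ) := by
  refine ⟨fun x σ σ' hs => by beta_reduce; rw [hGd x σ σ' hs, hb.1 x σ σ' hs, he.1 x σ σ' hs],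
    fun β hβ h3 => ?_⟩
  obtain ⟨ce, qe, hce⟩ := he.2 β hβ h3
  obtain ⟨cb, qb, hcb⟩ := hb.2 (β + 1) (by omega) (by omega)
  -- Cells from the counter on may contain remnants of earlier computations; they have to be read as
  -- `0`, as in `tabRec`.
  have hA : CptFun inp N (β + 4) fun x σ y => if y < σ (β + 2) 0 then σ (β + 3) y else 0 := by
    intro w' hw' y hy
    exact (ite_zero (sub (cell (a := β + 2) (by omega) (by omega)) hy) (lit 0)
      (get (a := β + 3) (by omega) (by omega) hy)).congr fun x σ => by
        beta_reduce
        split_ifs <;> first | rfl | omega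
  have hbody := hG (β + 4) (by omega) _ _ (cell (a := β + 2) (by omega) (by omega)) hA
  obtain ⟨cg, qg, hcg⟩ := hbody.2 (β + 4) le_rfl (by omega)
  refine ⟨.seq ce (.seq cb (.seq (.set (β + 2) (.lit 0) (.lit 0)) (.seq
    (forLoop (β + 2) (β + 1) (.seq cg
      (.set (β + 3) (.get (β + 2) (.lit 0)) (.get (β + 4) (.lit 0)))))
    (.ite (.sub (.get (β + 1) (.lit 0)) (.get β (.lit 0)))
      (.set β (.lit 0) (.get (β + 3) (.get β (.lit 0)))) (.set β (.lit 0) (.lit 0)))))),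
    qe + qb + (.X + 1) * (qg + .C 20) + .C 50, fun x σ h0 h2 => ?_⟩
  obtain ⟨t₁, σ₁, he₁, ht₁, hs₁, hv₁⟩ := hce x σ h0 h2
  obtain ⟨t₂, σ₂, he₂, ht₂, hs₂, hv₂⟩ := hcb x σ₁ (by rw [hs₁ 0 (by omega), h0])
    (by rw [hs₁ 2 (by omega), h2])
  rw [hb.1 x σ₁ σ fun a _ ha => hs₁ a (by omega)] at hv₂
  let Inv : ℕ → Store → Prop := fun k τ => (∀ a < β, τ a = σ a) ∧ τ β 0 = e x σ ∧
    τ (β + 1) 0 = b x σ ∧ τ (β + 2) 0 = k ∧ ∀ y < k, τ (β + 3) y = tabRec (G x σ) k y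
  obtain ⟨t₃, σ₃, he₃, ht₃, hI₁, hI₂, hI₃, hI₄, hI₅⟩ := exec_forLoop (kk := β + 2) (lim := β + 1)
    (B := b x σ) (τ := qg.eval (N x) + 6)
    (body := .seq cg (.set (β + 3) (.get (β + 2) (.lit 0)) (.get (β + 4) (.lit 0))))
    (Inv := Inv) (fun k τ hI => ⟨hI.2.2.1, hI.2.2.2.1⟩) (by
      rintro k hk τ ⟨hτ₁, hτ₂, hτ₃, hτ₄, hτ₅⟩
      obtain ⟨t, τ', het, ht, hs, hv⟩ := hcg x τ (by rw [hτ₁ 0 (by omega), h0])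
        (by rw [hτ₁ 2 (by omega), h2])
      have hfun : (fun y => if y < τ (β + 2) 0 then τ (β + 3) y else 0) = tabRec (G x σ) k := by
        funext y
        rw [hτ₄]
        split_ifs with hy
        · exact hτ₅ y hy
        · exact (tabRec_of_le _ (by omega)).symm
      simp only [hτ₄] at hv
      rw [hGd x τ σ fun a _ ha => hτ₁ a (by omega)] at hv
      simp only [hτ₄] at hfun
      rw [hfun] at hv
      have hk' : τ' (β + 2) 0 = k := by rw [hs _ (by omega), hτ₄]
      refine ⟨_, _, Exec.seq het (Exec.set _ _ _ _), by simp [Expr.cost]; omega, ?_, ?_⟩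
      · rw [Store.write_ne _ _ _ (by omega), hk']
      · refine ⟨fun a ha => ?_, ?_, ?_, Store.write_same _ _ _ _, fun y hy => ?_⟩
        · rw [Store.write_ne _ _ _ (by omega), Store.write_ne _ _ _ (by omega), hs a (by omega),
            hτ₁ a ha]
        · rw [Store.write_ne _ _ _ (by omega), Store.write_ne _ _ _ (by omega), hs β (by omega), hτ₂]
        · rw [Store.write_ne _ _ _ (by omega), Store.write_ne _ _ _ (by omega), hs _ (by omega),
            hτ₃]
        · rw [Store.write_ne _ _ _ (by omega)]
          simp only [Expr.eval, hk', hv]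
          rw [tabRec]
          rcases eq_or_ne y k with rfl | hne
          · rw [Store.write_same]; simp
          · rw [Store.write_ne_idx _ _ _ hne, Function.update_of_ne hne, hs _ (by omega)]
            exact hτ₅ y (by omega)) (b x σ) 0 (σ₂.write (β + 2) 0 0) (by omega)
    ⟨fun a ha => by rw [Store.write_ne _ _ _ (by omega), hs₂ a (by omega), hs₁ a ha],
      by rw [Store.write_ne _ _ _ (by omega), hs₂ β (by omega), hv₁],
      by rw [Store.write_ne _ _ _ (by omega), hv₂], Store.write_same _ _ _ _,
      fun y hy => absurd hy (by omega)⟩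
  have hcost : b x σ * (qg.eval (N x) + 6 + 12) ≤ (N x + 1) * (qg.eval (N x) + 20) :=
    Nat.mul_le_mul (hbN x σ) (by omega)
  have hset := Exec.set (β + 2) (.lit 0) (.lit 0) σ₂
  simp only [Expr.eval] at hset
  by_cases hlt : e x σ < b x σ
  · refine ⟨_, _, Exec.seq he₁ (Exec.seq he₂ (Exec.seq hset (Exec.seq he₃ (Exec.ite_true
      (by simp only [Expr.eval, hI₂, hI₃]; omega) (Exec.set _ _ _ _))))), ?_, fun a ha => ?_, ?_⟩
    · simp [Expr.cost]; omega
    · rw [Store.write_ne _ _ _ (by omega), hI₁ a ha]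
    · simp only [Expr.eval, hI₂]
      rw [Store.write_same, hI₅ _ hlt]
  · refine ⟨_, _, Exec.seq he₁ (Exec.seq he₂ (Exec.seq hset (Exec.seq he₃ (Exec.ite_false
      (by simp only [Expr.eval, hI₂, hI₃]; omega) (Exec.set _ _ _ _))))), ?_, fun a ha => ?_, ?_⟩
    · simp [Expr.cost]; omega
    · rw [Store.write_ne _ _ _ (by omega), hI₁ a ha]
    · simp only [Expr.eval]
      rw [Store.write_same, tabRec_of_le _ (by omega)]

/-- Round `k` is stored in cell `k` of a table, which therefore needs one cell more than there are
rounds; this is why `tab` admits the length `N x + 1`. -/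
theorem iter {a b : ι → Store → ℕ} {G : ι → Store → ℕ → ℕ → ℕ}
    (ha : Cpt inp N w a) (hb : Cpt inp N w b) (hbN : ∀ x σ, b x σ ≤ N x)
    (hG : ∀ w' ≥ w, ∀ u v, Cpt inp N w' u → Cpt inp N w' v →
      Cpt inp N w' fun x σ => G x σ (u x σ) (v x σ)) :
    Cpt inp N w fun x σ => iterN (a x σ) (G x σ) (b x σ) := by
  -- On which memories `G` depends can be seen from `hG` at constant arguments.
  have hd : ∀ x σ σ', (∀ a, 3 ≤ a → a < w → σ a = σ' a) → G x σ = G x σ' := fun x σ σ' hs =>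
    funext fun k => funext fun u => (hG w le_rfl _ _ (lit k) (lit u)).1 x σ σ' hs
  have := tab (G := fun x σ k A => if k = 0 then a x σ else G x σ (k - 1) (A (k - 1)))
    (hb.add (lit 1)) (fun x σ => Nat.add_le_add_right (hbN x σ) 1)
    (fun x σ σ' hs => by rw [ha.1 x σ σ' hs, hd x σ σ' hs])
    (fun w' hw z A hz hA => ite_zero hz (ha.mono hw)
      (hG w' hw _ _ (hz.sub (lit 1)) (hA w' le_rfl _ (hz.sub (lit 1))))) hb
  exact this.congr fun x σ => (tabRec_eq_iterN _ _ _).symm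

end Cpt

/-- The minimum of `g 0, …, g (b - 1)`. -/
def minN (g : ℕ → ℕ) (b : ℕ) : ℕ :=
  iterN (g 0) (fun k acc => min acc (g k)) b

theorem minN_le (g : ℕ → ℕ) {b k : ℕ} (h : k < b) : minN g b ≤ g k := by
  induction b with
  | zero => omega
  | succ b ih =>
    rcases eq_or_ne k b with rfl | hne
    · exact min_le_right _ _
    · exact (min_le_left _ _).trans (ih (by omega))

theorem exists_minN_eq (g : ℕ → ℕ) {b : ℕ} (h : 0 < b) : ∃ k < b, minN g b = g k := by
  suffices H : ∀ b, ∃ k, (k < b ∨ k = 0) ∧ minN g b = g k by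
    obtain ⟨k, hk, he⟩ := H b
    exact ⟨k, by omega, he⟩
  intro b
  induction b with
  | zero => exact ⟨0, Or.inr rfl, rfl⟩
  | succ b ih =>
    obtain ⟨k, hk, he⟩ := ih
    rcases min_choice (minN g b) (g b) with hm | hm
    · exact ⟨k, by omega, hm.trans he⟩
    · exact ⟨b, by omega, hm⟩

open Classical in
/-- A number `k < b` with `p k`, if there is one. -/
noncomputable def findN (p : ℕ → Prop) (b : ℕ) : ℕ :=
  iterN 0 (fun k acc => if p k then k else acc) b

theorem findN_spec {p : ℕ → Prop} {b : ℕ} (h : ∃ k < b, p k) : findN p b < b ∧ p (findN p b) := by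
  induction b with
  | zero => obtain ⟨k, hk, _⟩ := h; omega
  | succ b ih =>
    classical
    have hs : findN p (b + 1) = if p b then b else findN p b := by
      simp only [findN, iterN]
    by_cases hb : p b
    · rw [hs, if_pos hb]; exact ⟨by omega, hb⟩
    · rw [hs, if_neg hb]
      obtain ⟨k, hk, hp⟩ := h
      have hne : k ≠ b := fun e => hb (e ▸ hp)
      obtain ⟨h1, h2⟩ := ih ⟨k, by omega, hp⟩
      exact ⟨by omega, h2⟩

namespace Cpt

variable {ι : Type} {inp : ι → ℕ → ℕ} {N : ι → ℕ} {w : ℕ} {f g h : ι → Store → ℕ}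
  {p r : ι → Store → Prop}

theorem min (hf : Cpt inp N w f) (hg : Cpt inp N w g) :
    Cpt inp N w fun x σ => min (f x σ) (g x σ) :=
  (hf.sub (hf.sub hg)).congr fun x σ => by omega

theorem sum {b : ι → Store → ℕ} {G : ι → Store → ℕ → ℕ} (hb : Cpt inp N w b)
    (hbN : ∀ x σ, b x σ ≤ N x)
    (hG : ∀ w' ≥ w, ∀ v, Cpt inp N w' v → Cpt inp N w' fun x σ => G x σ (v x σ)) :
    Cpt inp N w fun x σ => ∑ k ∈ Finset.range (b x σ), G x σ k := by
  refine (iter (G := fun x σ k acc => acc + G x σ k) (lit 0) hb hbN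
    fun w' hw u v hu hv => hv.add (hG w' hw u hu)).congr fun x σ => ?_
  induction b x σ with
  | zero => rfl
  | succ k ih => rw [Finset.sum_range_succ, ih]; rfl

/-- Repeated addition. Only the second factor has to be bounded; the first may be as large as a
release date. -/
theorem mul (hf : Cpt inp N w f) (hg : Cpt inp N w g) (hgN : ∀ x σ, g x σ ≤ N x) :
    Cpt inp N w fun x σ => f x σ * g x σ :=
  (sum (G := fun x σ _ => f x σ) hg hgN fun _ hw _ _ => hf.mono hw).congr fun x σ => by
    simp [mul_comm]

theorem pow (hf : Cpt inp N w f) (hfN : ∀ x σ, f x σ ≤ N x) (hg : Cpt inp N w g)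
    (hgN : ∀ x σ, g x σ ≤ N x) : Cpt inp N w fun x σ => f x σ ^ g x σ := by
  refine (iter (G := fun x σ _ acc => acc * f x σ) (lit 1) hg hgN
    fun w' hw u v _ hv => hv.mul (hf.mono hw) hfN).congr fun x σ => ?_
  induction g x σ with
  | zero => rfl
  | succ k ih => rw [pow_succ, ih]; rfl

end Cpt

namespace CptP

variable {ι : Type} {inp : ι → ℕ → ℕ} {N : ι → ℕ} {w : ℕ} {f g : ι → Store → ℕ}
  {p r : ι → Store → Prop}

theorem congr (hp : CptP inp N w p) (h : ∀ x σ, r x σ ↔ p x σ) : CptP inp N w r := by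
  rwa [show r = p from funext fun x => funext fun σ => propext (h x σ)]

theorem eq_zero (hf : Cpt inp N w f) : CptP inp N w fun x σ => f x σ = 0 :=
  (Cpt.ite_zero hf (Cpt.lit 1) (Cpt.lit 0)).congr fun x σ => by
    split_ifs <;> rfl

theorem not (hp : CptP inp N w p) : CptP inp N w fun x σ => ¬ p x σ :=
  (eq_zero hp).congr fun x σ => by by_cases h : p x σ <;> simp [h]

theorem and (hp : CptP inp N w p) (hr : CptP inp N w r) : CptP inp N w fun x σ => p x σ ∧ r x σ :=
  (eq_zero (Cpt.add hp.not hr.not)).congr fun x σ => by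
    by_cases h : p x σ <;> by_cases h' : r x σ <;> simp [h, h']

theorem or (hp : CptP inp N w p) (hr : CptP inp N w r) : CptP inp N w fun x σ => p x σ ∨ r x σ :=
  (hp.not.and hr.not).not.congr fun x σ => by tauto

theorem imp (hp : CptP inp N w p) (hr : CptP inp N w r) : CptP inp N w fun x σ => p x σ → r x σ :=
  (hp.not.or hr).congr fun x σ => by tauto

theorem iff (hp : CptP inp N w p) (hr : CptP inp N w r) : CptP inp N w fun x σ => p x σ ↔ r x σ :=
  ((hp.imp hr).and (hr.imp hp)).congr fun x σ => by tauto

theorem le (hf : Cpt inp N w f) (hg : Cpt inp N w g) : CptP inp N w fun x σ => f x σ ≤ g x σ :=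
  (eq_zero (hf.sub hg)).congr fun x σ => by omega

theorem lt (hf : Cpt inp N w f) (hg : Cpt inp N w g) : CptP inp N w fun x σ => f x σ < g x σ :=
  (le hg hf).not.congr fun x σ => by omega

theorem eq (hf : Cpt inp N w f) (hg : Cpt inp N w g) : CptP inp N w fun x σ => f x σ = g x σ :=
  ((le hf hg).and (le hg hf)).congr fun x σ => by omega

theorem ne (hf : Cpt inp N w f) (hg : Cpt inp N w g) : CptP inp N w fun x σ => f x σ ≠ g x σ :=
  (eq hf hg).not

theorem all {b : ι → Store → ℕ} {G : ι → Store → ℕ → Prop} (hb : Cpt inp N w b)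
    (hbN : ∀ x σ, b x σ ≤ N x)
    (hG : ∀ w' ≥ w, ∀ v, Cpt inp N w' v → CptP inp N w' fun x σ => G x σ (v x σ)) :
    CptP inp N w fun x σ => ∀ k < b x σ, G x σ k := by
  classical
  refine (eq_zero (Cpt.sum (G := fun x σ k => if ¬ G x σ k then 1 else 0) hb hbN
    fun w' hw v hv => (Cpt.ite (hG w' hw v hv).not (Cpt.lit 1) (Cpt.lit 0)))).congr fun x σ => ?_
  simp [Finset.sum_eq_zero_iff]

theorem ex {b : ι → Store → ℕ} {G : ι → Store → ℕ → Prop} (hb : Cpt inp N w b)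
    (hbN : ∀ x σ, b x σ ≤ N x)
    (hG : ∀ w' ≥ w, ∀ v, Cpt inp N w' v → CptP inp N w' fun x σ => G x σ (v x σ)) :
    CptP inp N w fun x σ => ∃ k < b x σ, G x σ k :=
  (all (G := fun x σ k => ¬ G x σ k) hb hbN fun w' hw v hv => (hG w' hw v hv).not).not.congr
    fun x σ => by push Not; rfl

end CptP

namespace Cpt

variable {ι : Type} {inp : ι → ℕ → ℕ} {N : ι → ℕ} {w : ℕ} {f g h : ι → Store → ℕ}
  {p r : ι → Store → Prop}

theorem card_filter {b : ι → Store → ℕ} {G : ι → Store → ℕ → Prop}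
    {dec : ∀ x σ, DecidablePred (G x σ)} (hb : Cpt inp N w b) (hbN : ∀ x σ, b x σ ≤ N x)
    (hG : ∀ w' ≥ w, ∀ v, Cpt inp N w' v → CptP inp N w' fun x σ => G x σ (v x σ)) :
    Cpt inp N w fun x σ => ((Finset.range (b x σ)).filter (G x σ)).card :=
  (sum (G := fun x σ k => if G x σ k then 1 else 0) hb hbN fun w' hw v hv =>
    ite (hG w' hw v hv) (lit 1) (lit 0)).congr fun _ _ => Finset.card_filter _ _

theorem bound : Cpt inp N w fun x _ => N x := by
  refine ⟨fun _ _ _ _ => rfl, fun b _ _ => ⟨.set b (.lit 0) (.get 2 (.lit 0)), .C 10,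
    fun x σ _ h2 => ⟨_, _, Exec.set _ _ _ _, by simp [Expr.cost],
      fun a ha => Store.write_ne _ _ _ (by omega), ?_⟩⟩⟩
  simp only [Expr.eval, h2]
  exact Store.write_same _ _ _ _

/-- The quotient is the number of `k < N x` with `(k + 1) * g ≤ f`, whence the bound on the
dividend. -/
theorem div (hf : Cpt inp N w f) (hfN : ∀ x σ, f x σ ≤ N x) (hg : Cpt inp N w g)
    (hgN : ∀ x σ, g x σ ≤ N x) : Cpt inp N w fun x σ => f x σ / g x σ := by
  refine (ite_zero hg (lit 0) (card_filter (G := fun x σ k => (k + 1) * g x σ ≤ f x σ)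
    (b := fun x _ => N x) (dec := fun _ _ _ => inferInstance) bound (fun _ _ => le_rfl)
    fun w' hw v hv => CptP.le ((hv.add (lit 1)).mul (hg.mono hw) hgN)
      (hf.mono hw))).congr fun x σ => ?_
  beta_reduce
  split_ifs with h0
  · rw [h0, Nat.div_zero]
  · have : (Finset.range (N x)).filter (fun k => (k + 1) * g x σ ≤ f x σ) =
        Finset.range (f x σ / g x σ) := by
      ext k
      rw [Finset.mem_filter, Finset.mem_range, Finset.mem_range,
        ← Nat.le_div_iff_mul_le (Nat.pos_of_ne_zero h0)]
      have := (Nat.div_le_self (f x σ) (g x σ)).trans (hfN x σ)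
      omega
    rw [this, Finset.card_range]

theorem mod (hf : Cpt inp N w f) (hfN : ∀ x σ, f x σ ≤ N x) (hg : Cpt inp N w g)
    (hgN : ∀ x σ, g x σ ≤ N x) : Cpt inp N w fun x σ => f x σ % g x σ :=
  (hf.sub ((hf.div hfN hg hgN).mul hg hgN)).congr fun x σ => by
    have := Nat.div_add_mod' (f x σ) (g x σ)
    omega

theorem minimum {b : ι → Store → ℕ} {G : ι → Store → ℕ → ℕ} (hb : Cpt inp N w b)
    (hbN : ∀ x σ, b x σ ≤ N x)
    (hG : ∀ w' ≥ w, ∀ v, Cpt inp N w' v → Cpt inp N w' fun x σ => G x σ (v x σ)) :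
    Cpt inp N w fun x σ => minN (G x σ) (b x σ) :=
  iter (G := fun x σ k acc => Min.min acc (G x σ k)) (hG w le_rfl _ (lit 0)) hb hbN
    fun w' hw u _ hu hv => hv.min (hG w' hw u hu)

theorem find {b : ι → Store → ℕ} {G : ι → Store → ℕ → Prop} (hb : Cpt inp N w b)
    (hbN : ∀ x σ, b x σ ≤ N x)
    (hG : ∀ w' ≥ w, ∀ v, Cpt inp N w' v → CptP inp N w' fun x σ => G x σ (v x σ)) :
    Cpt inp N w fun x σ => findN (G x σ) (b x σ) := by
  classical
  exact (iter (G := fun x σ k acc => if G x σ k then k else acc) (lit 0) hb hbN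
    fun w' hw u _ hu hv => ite (hG w' hw u hu) hu hv).congr fun x σ => by
      simp only [findN]

theorem polynomial {n : ι → ℕ} (hn : Cpt inp N w fun x _ => n x) (hnN : ∀ x, n x ≤ N x)
    (q : Polynomial ℕ) : Cpt inp N w fun x _ => q.eval (n x) := by
  induction q using Polynomial.induction_on with
  | C a => exact (lit a).congr fun _ _ => Polynomial.eval_C
  | add q q' h h' => exact (h.add h').congr fun _ _ => Polynomial.eval_add
  | monomial k a h =>
    refine (h.mul hn fun x _ => hnN x).congr fun x _ => ?_
    simp [pow_succ, mul_assoc]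

end Cpt

/-! ### From computable entries of a solution to a program. -/

/-- A sequence whose entries can be computed can be written into memory `1`. -/
theorem exists_prog_output {ι : Type} {inp : ι → ℕ → ℕ} {N : ι → ℕ} {f : ι → ℕ → ℕ} {len : ι → ℕ}
    (hf : ∀ w v, Cpt inp N w v → Cpt inp N w fun x σ => f x (v x σ))
    (hlen : Cpt inp N 3 fun x _ => len x) (hle : ∀ x, len x ≤ N x) :
    ∃ (c : Prog) (q : Polynomial ℕ), ∀ x σ, σ 0 = inp x → σ 2 0 = N x →
      ∃ t σ', Exec c σ t σ' ∧ t ≤ q.eval (N x) ∧ ∀ k < len x, σ' 1 k = f x k := by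
  obtain ⟨cl, ql, hcl⟩ := hlen.2 3 le_rfl le_rfl
  obtain ⟨cf, qf, hcf⟩ := (hf 5 _ (Cpt.cell (a := 4) (by omega) (by omega))).2 5 le_rfl (by omega)
  refine ⟨.seq cl (.seq (.set 4 (.lit 0) (.lit 0)) (forLoop 4 3 (.seq cf
    (.set 1 (.get 4 (.lit 0)) (.get 5 (.lit 0)))))), ql + .X * (qf + .C 20) + .C 20,
    fun x σ h0 h2 => ?_⟩
  obtain ⟨t₁, σ₁, he₁, ht₁, hs₁, hv₁⟩ := hcl x σ h0 h2
  let Inv : ℕ → Store → Prop := fun k τ => τ 0 = inp x ∧ τ 2 0 = N x ∧ τ 3 0 = len x ∧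
    τ 4 0 = k ∧ ∀ y < k, τ 1 y = f x y
  obtain ⟨t₃, σ₃, he₃, ht₃, hI⟩ := exec_forLoop (kk := 4) (lim := 3)
    (B := len x) (τ := qf.eval (N x) + 6)
    (body := .seq cf (.set 1 (.get 4 (.lit 0)) (.get 5 (.lit 0))))
    (Inv := Inv) (fun k τ hI => ⟨hI.2.2.1, hI.2.2.2.1⟩) (by
      rintro k hk τ ⟨hτ₁, hτ₂, hτ₃, hτ₄, hτ₅⟩
      obtain ⟨t, τ', het, ht, hs, hv⟩ := hcf x τ hτ₁ hτ₂
      simp only [hτ₄] at hv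
      have hk' : τ' 4 0 = k := by rw [hs _ (by omega), hτ₄]
      refine ⟨_, _, Exec.seq het (Exec.set _ _ _ _), by simp [Expr.cost]; omega, ?_, ?_⟩
      · rw [Store.write_ne _ _ _ (by omega), hk']
      · refine ⟨?_, ?_, ?_, Store.write_same _ _ _ _, fun y hy => ?_⟩
        · rw [Store.write_ne _ _ _ (by omega), Store.write_ne _ _ _ (by omega), hs _ (by omega), hτ₁]
        · rw [Store.write_ne _ _ _ (by omega), Store.write_ne _ _ _ (by omega), hs _ (by omega), hτ₂]
        · rw [Store.write_ne _ _ _ (by omega), Store.write_ne _ _ _ (by omega), hs _ (by omega), hτ₃]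
        · rw [Store.write_ne _ _ _ (by omega)]
          simp only [Expr.eval, hk', hv]
          rcases eq_or_ne y k with rfl | hne
          · rw [Store.write_same]
          · rw [Store.write_ne_idx _ _ _ hne, hs _ (by omega)]
            exact hτ₅ y (by omega)) (len x) 0 (σ₁.write 4 0 0) (by omega)
    ⟨by rw [Store.write_ne _ _ _ (by omega), hs₁ 0 (by omega), h0],
      by rw [Store.write_ne _ _ _ (by omega), hs₁ 2 (by omega), h2],
      by rw [Store.write_ne _ _ _ (by omega), hv₁], Store.write_same _ _ _ _,
      fun y hy => absurd hy (by omega)⟩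
  have hcost : len x * (qf.eval (N x) + 6 + 12) ≤ N x * (qf.eval (N x) + 20) :=
    Nat.mul_le_mul (hle x) (by omega)
  have hset := Exec.set 4 (.lit 0) (.lit 0) σ₁
  simp only [Expr.eval] at hset
  refine ⟨_, _, Exec.seq he₁ (Exec.seq hset he₃), ?_, hI.2.2.2.2⟩
  simp [Expr.cost]; omega

theorem eval_le_eval (q : Polynomial ℕ) {a b : ℕ} (h : a ≤ b) : q.eval a ≤ q.eval b := by
  rw [Polynomial.eval_eq_sum, Polynomial.eval_eq_sum]
  exact Finset.sum_le_sum fun i _ => Nat.mul_le_mul_left _ (Nat.pow_le_pow_left h i)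

/-- A search problem is solvable in polynomial time if the entries of a solution can be computed
in the sense of `Cpt`, with a bound that is a polynomial in entry `1` of the input. -/
theorem solvableInPolyTime_of_cpt {α : Type} {enc : α → List ℕ} {P : α → Prop}
    {Sol : α → (ℕ → ℕ) → Prop} {f : {x // P x} → ℕ → ℕ} {n len : {x // P x} → ℕ}
    (R : Polynomial ℕ)
    (hn : ∀ x, (enc x.1).getD 1 0 = n x) (hsize : ∀ x, n x ≤ bitSize (enc x.1))
    (hf : ∀ w v, Cpt (fun x i => (enc x.1).getD i 0) (fun x => R.eval (n x)) w v →
      Cpt (fun x i => (enc x.1).getD i 0) (fun x => R.eval (n x)) w fun x σ => f x (v x σ))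
    (hlen : Cpt (fun x i => (enc x.1).getD i 0) (fun x => R.eval (n x)) 3 fun x _ => len x)
    (hle : ∀ x, len x ≤ R.eval (n x))
    (hsol : ∀ x out, (∀ k < len x, out k = f x k) → Sol x.1 out) :
    SolvableInPolyTime enc P Sol := by
  obtain ⟨c₂, q₂, hc₂⟩ := exists_prog_output hf hlen hle
  -- The loop bound `R.eval n` is itself computed by a program with loop bound `n`: memory `2` holds
  -- first `n` and later `R.eval n`.
  obtain ⟨c₁, q₁, hc₁⟩ := (Cpt.polynomial (ι := {x // P x}) (N := n) (n := n) (w := 3)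
    (inp := fun x i => (enc x.1).getD i 0)
    ((Cpt.input (Cpt.lit 1)).congr fun x _ => (hn x).symm) (fun _ => le_rfl) R).2 3 le_rfl le_rfl
  refine ⟨.seq (.set 2 (.lit 0) (.get 0 (.lit 1))) (.seq c₁
    (.seq (.set 2 (.lit 0) (.get 3 (.lit 0))) c₂)), q₁ + q₂.comp R + .C 20, fun y hy => ?_⟩
  obtain ⟨x, rfl⟩ : ∃ x : {x // P x}, x.1 = y := ⟨⟨y, hy⟩, rfl⟩
  have hinit : initStore (enc x.1) 0 = fun i => (enc x.1).getD i 0 := by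
    funext i; simp [initStore]
  have hset := Exec.set 2 (.lit 0) (.get 0 (.lit 1)) (initStore (enc x.1))
  simp only [Expr.eval, hinit, hn] at hset
  obtain ⟨t₁, σ₁, he₁, ht₁, hs₁, hv₁⟩ := hc₁ x ((initStore (enc x.1)).write 2 0 (n x))
    (by rw [Store.write_ne _ _ _ (by omega), hinit]) (Store.write_same _ _ _ _)
  have hset' := Exec.set 2 (.lit 0) (.get 3 (.lit 0)) σ₁
  simp only [Expr.eval, hv₁] at hset'
  obtain ⟨t₂, σ₂, he₂, ht₂, hout⟩ := hc₂ x (σ₁.write 2 0 (R.eval (n x)))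
    (by rw [Store.write_ne _ _ _ (by omega), hs₁ 0 (by omega),
      Store.write_ne _ _ _ (by omega), hinit]) (Store.write_same _ _ _ _)
  refine ⟨_, _, Exec.seq hset (Exec.seq he₁ (Exec.seq hset' he₂)), ?_, hsol x _ hout⟩
  have h₁ := eval_le_eval q₁ (hsize x)
  have h₂ := eval_le_eval q₂ (eval_le_eval R (hsize x))
  simp [Expr.cost, Polynomial.eval_comp]
  omega

/-! ### Positions of the data in the encoding of an instance. -/

theorem getD_flatten_ofFn {n l : ℕ} (f : Fin n → List ℕ) (hl : ∀ j, (f j).length = l) (j : Fin n)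
    {r : ℕ} (hr : r < l) : (List.ofFn f).flatten.getD (j * l + r) 0 = (f j).getD r 0 := by
  induction n with
  | zero => exact j.elim0
  | succ n ih =>
    rw [List.ofFn_succ, List.flatten_cons]
    refine Fin.cases ?_ (fun j => ?_) j
    · rw [List.getD_append _ _ _ _ (by simp [hl, hr])]
      simp
    · rw [List.getD_append_right _ _ _ _ (by simp [hl, Nat.succ_mul]; omega), ← ih (fun j => f j.succ)
        (fun j => hl _) j, hl]
      congr 1
      rw [Fin.val_succ, Nat.succ_mul]
      omega

theorem length_flatten_ofFn {n l : ℕ} (f : Fin n → List ℕ) (hl : ∀ j, (f j).length = l) :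
    (List.ofFn f).flatten.length = n * l := by
  rw [List.length_flatten, List.map_ofFn, List.sum_ofFn]
  simp [hl]

namespace Instance

/-- The data of an instance as functions of natural numbers: release dates. -/
def rel (I : Instance) (j : ℕ) : ℕ := if h : j < I.n then I.release ⟨j, h⟩ else 0

/-- Start segments. -/
def st (I : Instance) (j : ℕ) : ℕ := if h : j < I.n then (I.start ⟨j, h⟩ : ℕ) else 0

/-- Target segments. -/
def tg (I : Instance) (j : ℕ) : ℕ := if h : j < I.n then (I.target ⟨j, h⟩ : ℕ) else 0

/-- Direction. -/
def rt (I : Instance) (j : ℕ) : Prop := ∃ h : j < I.n, I.right ⟨j, h⟩ = true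

/-- Transit times. -/
def tr (I : Instance) (i : ℕ) : ℕ := if h : i < I.m then I.transit ⟨i, h⟩ else 0

/-- Compatibility on segment `i`. -/
def adjN (I : Instance) (i j j' : ℕ) : Prop :=
  ∃ (hi : i < I.m) (hj : j < I.n) (hj' : j' < I.n), (I.compat ⟨i, hi⟩).Adj ⟨j, hj⟩ ⟨j', hj'⟩

/-- The numbers that encode one job. -/
def jobCode (I : Instance) (j : Fin I.n) : List ℕ :=
  [if I.right j = true then 1 else 0, I.release j, (I.start j : ℕ), (I.target j : ℕ), I.proc j]

open Classical in
/-- The adjacency matrix of one segment. -/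
noncomputable def adjCode (I : Instance) (i : Fin I.m) : List ℕ :=
  (List.ofFn fun j => List.ofFn fun j' => if (I.compat i).Adj j j' then 1 else 0).flatten

theorem encode_eq (I : Instance) : I.encode = [I.m, I.n] ++ (List.ofFn I.transit ++
    ((List.ofFn I.jobCode).flatten ++ (List.ofFn I.adjCode).flatten)) := by
  simp only [encode, List.append_assoc]
  rfl

theorem length_adjCode (I : Instance) (i : Fin I.m) : (I.adjCode i).length = I.n * I.n :=
  length_flatten_ofFn _ fun _ => List.length_ofFn

theorem getD_encode_one (I : Instance) : I.encode.getD 1 0 = I.n := by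
  rw [encode_eq]; rfl

theorem getD_encode_transit (I : Instance) {i : ℕ} (hi : i < I.m) :
    I.encode.getD (i + 2) 0 = I.tr i := by
  rw [encode_eq, List.getD_append_right _ _ _ _ (by simp), List.getD_append _ _ _ _ (by simp [hi])]
  simp [tr, hi]

theorem getD_encode_job (I : Instance) (j : Fin I.n) {r : ℕ} (hr : r < 5) :
    I.encode.getD (I.m + (j * 5 + r) + 2) 0 = (I.jobCode j).getD r 0 := by
  rw [encode_eq, List.getD_append_right _ _ _ _ (by simp),
    List.getD_append_right _ _ _ _ (by simp), List.getD_append, ← getD_flatten_ofFn _ _ j hr]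
  · congr 1; simp
  · exact fun _ => rfl
  · rw [length_flatten_ofFn (l := 5) _ fun _ => rfl]
    have := j.2
    simp; omega

open Classical in
theorem getD_encode_adj (I : Instance) {i j j' : ℕ} (hi : i < I.m) (hj : j < I.n) (hj' : j' < I.n) :
    I.encode.getD (I.m + (I.n * 5 + ((i * I.n + j) * I.n + j')) + 2) 0 =
      if I.adjN i j j' then 1 else 0 := by
  have hlen : (List.ofFn I.jobCode).flatten.length = I.n * 5 := length_flatten_ofFn _ fun _ => rfl
  rw [encode_eq, List.getD_append_right _ _ _ _ (by simp),
    List.getD_append_right _ _ _ _ (by simp),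
    List.getD_append_right _ _ _ _ (by rw [hlen]; simp), hlen]
  have hlt : j * I.n + j' < I.n * I.n := by nlinarith
  have h1 := getD_flatten_ofFn I.adjCode (length_adjCode I) ⟨i, hi⟩ hlt
  have h2 := getD_flatten_ofFn (fun j => List.ofFn fun j' =>
    if (I.compat ⟨i, hi⟩).Adj j j' then 1 else 0) (fun _ => List.length_ofFn) ⟨j, hj⟩ hj'
  have hidx : I.m + (I.n * 5 + ((i * I.n + j) * I.n + j')) + 2 - [I.m, I.n].length -
      (List.ofFn I.transit).length - I.n * 5 = i * (I.n * I.n) + (j * I.n + j') := by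
    simp only [List.length_cons, List.length_nil, List.length_ofFn]
    rw [show i * (I.n * I.n) + (j * I.n + j') = (i * I.n + j) * I.n + j' by ring]
    omega
  rw [hidx]
  refine h1.trans (h2.trans ?_)
  simp [adjN, hi, hj, hj']

theorem n_le_bitSize (I : Instance) : I.n ≤ bitSize I.encode := by
  have h1 : ∀ l : List ℕ, l.length ≤ bitSize l := fun l => by
    induction l with
    | nil => simp [bitSize]
    | cons a l ih => simp [bitSize] at ih ⊢; omega
  refine le_trans ?_ (h1 _)
  rw [encode_eq]
  simp only [List.length_append, length_flatten_ofFn (l := 5) I.jobCode fun _ => rfl]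
  omega

end Instance

/-- The instances with `m` segments, at most `κ` compatibility types, all processing times `p`, and
crossing times between `1` and `L`. -/
def Restricted (m κ p L : ℕ) (I : Instance) : Prop :=
  I.m = m ∧ I.numTypes ≤ κ ∧ (∀ j, I.proc j = p) ∧
    ∀ i, 1 ≤ p + I.transit i ∧ p + I.transit i ≤ L

/-! ### Computability of the data of an instance. -/

section Access

variable {m κ p L : ℕ} {N : {I // Restricted m κ p L I} → ℕ} {w : ℕ}
  {f g h : {I // Restricted m κ p L I} → Store → ℕ}

/-- Computability from the encoding of an instance. -/
abbrev CptI (N : {I // Restricted m κ p L I} → ℕ) (w : ℕ)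
    (f : {I // Restricted m κ p L I} → Store → ℕ) : Prop :=
  Cpt (fun x i => (Instance.encode x.1).getD i 0) N w f

/-- Decidability from the encoding of an instance. -/
abbrev CptPI (N : {I // Restricted m κ p L I} → ℕ) (w : ℕ)
    (f : {I // Restricted m κ p L I} → Store → Prop) : Prop :=
  CptP (fun x i => (Instance.encode x.1).getD i 0) N w f

theorem cpt_n : CptI N w fun x _ => x.1.n :=
  (Cpt.input (Cpt.lit 1)).congr fun x _ => x.1.getD_encode_one.symm

theorem cpt_m : CptI N w fun x _ => x.1.m :=
  (Cpt.lit m).congr fun x _ => x.2.1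

theorem cpt_tr (hf : CptI N w f) : CptI N w fun x σ => x.1.tr (f x σ) := by
  classical
  refine (Cpt.ite (CptP.lt hf cpt_m) (Cpt.input (hf.add (Cpt.lit 2))) (Cpt.lit 0)
    (dec := fun _ _ => inferInstance)).congr fun x σ => ?_
  split_ifs with h
  · exact (x.1.getD_encode_transit h).symm
  · simp [Instance.tr, h]

theorem cpt_job (r : ℕ) (hr : r < 5) (hf : CptI N w f) : CptI N w fun x σ =>
    if h : f x σ < x.1.n then (x.1.jobCode ⟨f x σ, h⟩).getD r 0 else 0 := by
  classical
  -- Adding five copies forms the address without `Cpt.mul`, which would require a bound on a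
  -- factor.
  refine (Cpt.ite (CptP.lt hf cpt_n) (Cpt.input ((cpt_m.add
    (((((hf.add hf).add hf).add hf).add hf).add (Cpt.lit r))).add (Cpt.lit 2))) (Cpt.lit 0)
    (dec := fun _ _ => inferInstance)).congr fun x σ => ?_
  split_ifs with h
  · rw [← x.1.getD_encode_job ⟨f x σ, h⟩ hr]
    congr 1
    simp; omega
  · rfl

theorem cpt_rel (hf : CptI N w f) : CptI N w fun x σ => x.1.rel (f x σ) :=
  (cpt_job 1 (by omega) hf).congr fun _ _ => rfl

theorem cpt_st (hf : CptI N w f) : CptI N w fun x σ => x.1.st (f x σ) :=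
  (cpt_job 2 (by omega) hf).congr fun _ _ => rfl

theorem cpt_tg (hf : CptI N w f) : CptI N w fun x σ => x.1.tg (f x σ) :=
  (cpt_job 3 (by omega) hf).congr fun _ _ => rfl

theorem cpt_rt (hf : CptI N w f) : CptPI N w fun x σ => x.1.rt (f x σ) :=
  (cpt_job 0 (by omega) hf).congr fun x σ => by
    by_cases h : f x σ < x.1.n <;> simp [Instance.rt, h, Instance.jobCode]

theorem cpt_adjN (hn : ∀ x, x.1.n ≤ N x) (hf : CptI N w f) (hg : CptI N w g) (hh : CptI N w h) :
    CptPI N w fun x σ => x.1.adjN (f x σ) (g x σ) (h x σ) := by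
  classical
  refine ((CptP.lt hf cpt_m).and ((CptP.lt hg cpt_n).and ((CptP.lt hh cpt_n).and (CptP.ne (Cpt.input
    ((cpt_m.add (((((cpt_n.add cpt_n).add cpt_n).add cpt_n).add cpt_n).add ((((hf.mul cpt_n
    fun x _ => hn x).add hg).mul cpt_n fun x _ => hn x).add hh))).add (Cpt.lit 2)))
    (Cpt.lit 0))))).congr fun x σ => ?_
  constructor
  · intro hadj
    have hadj' := hadj
    obtain ⟨hi, hj, hj', -⟩ := hadj
    refine ⟨hi, hj, hj', ?_⟩
    have := x.1.getD_encode_adj hi hj hj'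
    rw [if_pos hadj'] at this
    rw [show ∀ a, a + a + a + a + a = a * 5 by intro a; omega, this]
    omega
  · rintro ⟨hi, hj, hj', hne⟩
    have := x.1.getD_encode_adj hi hj hj'
    rw [show ∀ a, a + a + a + a + a = a * 5 by intro a; omega, this] at hne
    by_contra hadj
    exact hne (if_neg hadj)

end Access

namespace Instance

variable (I : Instance) (κ p L : ℕ)

/-! ### The slots: a polynomial number of relevant points in time -/

/-- `t` is a relevant point in time: it comes not long after a release date. -/
def Active (t : ℕ) : Prop :=
  -- The summand `n * m * L` covers all tight start times, the further `L` the points reached from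
  -- them by one distance. The second alternative makes all late points active, so that there always
  -- is a next one.
  (∃ j < I.n, I.rel j ≤ t ∧ t ≤ I.rel j + (I.n * I.m * L + L)) ∨ ∀ j < I.n, I.rel j ≤ t

open Classical in
/-- The first relevant point in time from `t` on. -/
noncomputable def nextActive (t : ℕ) : ℕ :=
  if I.Active L t then t else
    I.rel (findN (fun j => t < I.rel j ∧ ∀ j' < I.n, t < I.rel j' → I.rel j ≤ I.rel j') I.n)

/-- The number of slots. -/
def slots : ℕ := (I.n * I.m * L + L + 1) * I.n + 1

/-- The point in time of the `q`-th slot. -/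
noncomputable def slot (q : ℕ) : ℕ :=
  -- `Cpt` asks for polynomial time at every argument; hence the cap by `min` here and in `digit`,
  -- `pathState` and `output`.
  iterN (I.nextActive L 0) (fun _ t => I.nextActive L (t + 1)) (min q (I.slots L))

/-! ### Classes of interchangeable jobs -/

/-- Jobs of the same direction with the same start, target and neighbours. -/
def Same (j j' : ℕ) : Prop :=
  (I.rt j ↔ I.rt j') ∧ I.st j = I.st j' ∧ I.tg j = I.tg j' ∧
    ∀ i < I.m, ∀ k < I.n, I.adjN i j k ↔ I.adjN i j' k

/-- The first job of its class. -/
def IsRep (j : ℕ) : Prop := ∀ j' < I.n, j' < j → ¬ I.Same j' j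

open Classical in
/-- The number of the class of job `j`. -/
noncomputable def cls (j : ℕ) : ℕ :=
  ((Finset.range I.n).filter fun j' =>
    I.IsRep j' ∧ ∃ k < I.n, I.IsRep k ∧ I.Same k j ∧ j' < k).card

/-- A job of class `c`. -/
noncomputable def member (c : ℕ) : ℕ := findN (fun j => I.cls j = c) I.n

/-- The number of jobs of class `c`. -/
noncomputable def classSize (c : ℕ) : ℕ := ((Finset.range I.n).filter fun j => I.cls j = c).card

/-- The position of job `j` within its class, by release dates. -/
noncomputable def rank (j : ℕ) : ℕ :=
  ((Finset.range I.n).filter fun j' =>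
    I.cls j' = I.cls j ∧ (I.rel j' < I.rel j ∨ I.rel j' = I.rel j ∧ j' < j)).card

/-- A bound on the number of classes. -/
def classBound : ℕ := κ * I.m * I.m

/-! ### Paths and conflicts -/

/-- Job `j` crosses segment `i`. -/
def OnPath (j i : ℕ) : Prop := I.st j ≤ i ∧ i ≤ I.tg j ∨ I.tg j ≤ i ∧ i ≤ I.st j

/-- Job `j` crosses segment `i'` right after segment `i`. -/
def Follows (j i i' : ℕ) : Prop :=
  I.OnPath j i ∧ I.OnPath j i' ∧ (I.rt j ∧ i' = i + 1 ∨ ¬ I.rt j ∧ i = i' + 1)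

open Classical in
/-- The least distance of the start times of `j` and `j'` on segment `i`. -/
noncomputable def gap (j j' i : ℕ) : ℕ :=
  if I.rt j ↔ I.rt j' then p else if I.adjN i j j' then 0 else p + I.tr i

/-! ### The dynamic program -/

/-- The number of digits of a state. -/
def digits : ℕ := I.classBound κ * I.m * (L + 1)

/-- The number of states. -/
def states : ℕ := (I.n + 1) ^ I.digits κ L

/-- The number of jobs of class `c` that were started on segment `i` at least `k` slots before the
slot that follows state `x`. -/
def digit (x c i k : ℕ) : ℕ :=
  min x (I.states κ L - 1) / (I.n + 1) ^ min ((c * I.m + i) * (L + 1) + k) (I.digits κ L) % (I.n + 1)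

/-- State `y` may follow state `x` by starting jobs in slot `q`. -/
def Valid (q x y : ℕ) : Prop :=
  (∀ c < I.classBound κ, ∀ i < I.m,
    (∀ k < L, I.digit κ L y c i (k + 1) = I.digit κ L x c i k) ∧
      I.digit κ L x c i 0 ≤ I.digit κ L y c i 0) ∧
  -- If a class is served in the order of release dates, comparing numbers of jobs decides about
  -- release dates and, in the next clause, about travel.
  (∀ c < I.classBound κ, I.digit κ L y c (I.st (I.member c)) 0 ≤
    ((Finset.range I.n).filter fun j => I.cls j = c ∧ I.rel j ≤ I.slot L q).card) ∧
  (∀ c < I.classBound κ, ∀ i < I.m, ∀ i' < I.m, I.Follows (I.member c) i i' →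
    I.digit κ L y c i' 0 ≤ I.digit κ L y c i (p + I.tr i)) ∧
  -- Among the last `gap` slots there must not be two conflicting starts: of two classes, one has no
  -- start there; a single class has at most one.
  ∀ c < I.classBound κ, ∀ c' < I.classBound κ, ∀ i < I.m,
    I.OnPath (I.member c) i → I.OnPath (I.member c') i →
    (c ≠ c' →
      I.digit κ L y c i 0 ≤ I.digit κ L y c i (I.gap p (I.member c) (I.member c') i) ∨
      I.digit κ L y c' i 0 ≤ I.digit κ L y c' i (I.gap p (I.member c) (I.member c') i)) ∧
    (c = c' → I.digit κ L y c i 0 ≤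
      I.digit κ L y c i (I.gap p (I.member c) (I.member c') i) + 1)

/-- In state `x` all jobs have been started on all segments of their paths. -/
def Final (x : ℕ) : Prop :=
  ∀ c < I.classBound κ, ∀ i < I.m, I.OnPath (I.member c) i → I.digit κ L x c i 0 = I.classSize c

/-- More than the cost of any schedule that uses the slots. -/
noncomputable def big : ℕ := I.slot L (I.slots L) * I.n + 1

/-- The sum of the start times on their target segments of the jobs started there between the
states `x` and `y` in slot `q`. -/
noncomputable def stepCost (q y : ℕ) : ℕ :=
  ∑ c ∈ Finset.range (I.classBound κ), I.slot L q *
    (I.digit κ L y c (I.tg (I.member c)) 0 - I.digit κ L y c (I.tg (I.member c)) 1)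

open Classical in
/-- The cost of a step, with a penalty for steps that are not valid. -/
noncomputable def weight (q x y : ℕ) : ℕ :=
  if I.Valid κ p L q x y then I.stepCost κ L q y else I.big L

open Classical in
/-- The cost of a final state, with a penalty for states that are not final. -/
noncomputable def finalWeight (x : ℕ) : ℕ := if I.Final κ L x then 0 else I.big L

/-- The least cost of the last `r` steps, started in state `x`. -/
noncomputable def value : ℕ → ℕ → ℕ
  | 0, x => I.finalWeight κ L x
  | r + 1, x => minN (fun y => I.weight κ p L (I.slots L - (r + 1)) x y + value r y) (I.states κ L)

/-- The state after `q` steps of an optimal sequence. -/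
noncomputable def pathState (q : ℕ) : ℕ :=
  iterN 0 (fun a x => findN (fun y => I.weight κ p L a x y + I.value κ p L (I.slots L - (a + 1)) y =
    I.value κ p L (I.slots L - a) x) (I.states κ L)) (min q (I.slots L))

/-- The slot in which job `j` is started on segment `i`. -/
noncomputable def startSlot (j i : ℕ) : ℕ :=
  ((Finset.range (I.slots L)).filter fun a =>
    I.digit κ L (I.pathState κ p L (a + 1)) (I.cls j) i 0 ≤ I.rank j).card

/-- The start times in the order of the output. -/
noncomputable def output (k : ℕ) : ℕ :=
  I.slot L (I.startSlot κ p L (min k (I.n * I.m) / I.m) (min k (I.n * I.m) % I.m))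

/-- A bound on the lengths of all loops. -/
def loopBound : ℕ :=
  I.states κ L * (I.slots L + 1) + I.states κ L + I.slots L + I.n + I.m + I.classBound κ +
    I.digits κ L + L + I.n * I.m + 1

end Instance

/-! ### Computability of the dynamic program. -/

section Computability

variable {m κ p L : ℕ} {N : {I // Restricted m κ p L I} → ℕ} {w : ℕ}
  {f g h k : {I // Restricted m κ p L I} → Store → ℕ}

theorem loopBound_bounds (I : Instance) (κ L : ℕ) : I.n + 1 ≤ I.loopBound κ L ∧
    I.n ≤ I.loopBound κ L ∧ I.m ≤ I.loopBound κ L ∧ I.classBound κ ≤ I.loopBound κ L ∧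
    I.digits κ L ≤ I.loopBound κ L ∧ L ≤ I.loopBound κ L ∧ I.slots L ≤ I.loopBound κ L ∧
    I.states κ L ≤ I.loopBound κ L ∧ I.states κ L * (I.slots L + 1) ≤ I.loopBound κ L ∧
    I.n * I.m ≤ I.loopBound κ L ∧ L + 1 ≤ I.loopBound κ L := by
  unfold Instance.loopBound Instance.slots
  refine ⟨?_, ?_, ?_, ?_, ?_, ?_, ?_, ?_, ?_, ?_, ?_⟩ <;> omega

/-- `N` bounds all loops. -/
def Bounding (N : {I // Restricted m κ p L I} → ℕ) : Prop :=
  ∀ x : {I // Restricted m κ p L I}, x.1.loopBound κ L ≤ N x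

theorem Bounding.bounds (hN : Bounding N) (x : {I // Restricted m κ p L I}) : x.1.n + 1 ≤ N x ∧
    x.1.n ≤ N x ∧ x.1.m ≤ N x ∧ x.1.classBound κ ≤ N x ∧
    x.1.digits κ L ≤ N x ∧ L ≤ N x ∧ x.1.slots L ≤ N x ∧
    x.1.states κ L ≤ N x ∧ x.1.states κ L * (x.1.slots L + 1) ≤ N x ∧
    x.1.n * x.1.m ≤ N x ∧ L + 1 ≤ N x := by
  have h := loopBound_bounds x.1 κ L
  have h' := hN x
  refine ⟨?_, ?_, ?_, ?_, ?_, ?_, ?_, ?_, ?_, ?_, ?_⟩ <;> omega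

theorem Bounding.n_le (hN : Bounding N) (x : {I // Restricted m κ p L I}) : x.1.n ≤ N x :=
  (hN.bounds x).2.1

theorem Bounding.m_le (hN : Bounding N) (x : {I // Restricted m κ p L I}) : x.1.m ≤ N x :=
  (hN.bounds x).2.2.1

theorem cpt_slots (hN : Bounding N) : CptI N w fun x _ => x.1.slots L :=
  ((Cpt.mul (((Cpt.mul (cpt_n.mul cpt_m fun x _ => hN.m_le x) (Cpt.lit L)
    fun x _ => (hN.bounds x).2.2.2.2.2.1).add (Cpt.lit L)).add (Cpt.lit 1)) cpt_n
    fun x _ => hN.n_le x).add (Cpt.lit 1)).congr fun _ _ => rfl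

theorem Bounding.slots_le (hN : Bounding N) (x : {I // Restricted m κ p L I}) :
    x.1.slots L ≤ N x := (hN.bounds x).2.2.2.2.2.2.1

theorem cpt_active (hN : Bounding N) (hf : CptI N w f) :
    CptPI N w fun x σ => x.1.Active L (f x σ) :=
  CptP.or (CptP.ex cpt_n (fun x _ => hN.n_le x) fun _ hw _ hv =>
      (CptP.le (cpt_rel hv) (hf.mono hw)).and (CptP.le (hf.mono hw) ((cpt_rel hv).add
        ((Cpt.mul (cpt_n.mul cpt_m fun x _ => hN.m_le x) (Cpt.lit L)
          fun x _ => (hN.bounds x).2.2.2.2.2.1).add (Cpt.lit L)))))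
    (CptP.all cpt_n (fun x _ => hN.n_le x) fun _ hw _ hv => CptP.le (cpt_rel hv) (hf.mono hw))

theorem cpt_nextActive (hN : Bounding N) (hf : CptI N w f) :
    CptI N w fun x σ => x.1.nextActive L (f x σ) :=
  Cpt.ite (cpt_active hN hf) hf (cpt_rel (Cpt.find cpt_n (fun x _ => hN.n_le x) fun _ hw _ hv =>
    CptP.and (CptP.lt (hf.mono hw) (cpt_rel hv)) (CptP.all cpt_n (fun x _ => hN.n_le x)
      fun _ hw' _ hv' => CptP.imp (CptP.lt (hf.mono (hw.trans hw')) (cpt_rel hv'))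
        (CptP.le (cpt_rel (hv.mono hw')) (cpt_rel hv')))))

theorem cpt_slot (hN : Bounding N) (hf : CptI N w f) : CptI N w fun x σ => x.1.slot L (f x σ) :=
  Cpt.iter (cpt_nextActive hN (Cpt.lit 0)) (hf.min (cpt_slots hN))
    (fun x _ => (min_le_right _ _).trans (hN.slots_le x))
    fun _ _ _ _ _ hv => cpt_nextActive hN (hv.add (Cpt.lit 1))

theorem cpt_same (hN : Bounding N) (hf : CptI N w f) (hg : CptI N w g) :
    CptPI N w fun x σ => x.1.Same (f x σ) (g x σ) :=
  CptP.and (CptP.iff (cpt_rt hf) (cpt_rt hg)) (CptP.and (CptP.eq (cpt_st hf) (cpt_st hg))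
    (CptP.and (CptP.eq (cpt_tg hf) (cpt_tg hg)) (CptP.all cpt_m (fun x _ => hN.m_le x)
      fun _ hw _ hv => CptP.all cpt_n (fun x _ => hN.n_le x) fun _ hw' _ hv' =>
        CptP.iff (cpt_adjN hN.n_le (hv.mono hw') (hf.mono (hw.trans hw')) hv')
          (cpt_adjN hN.n_le (hv.mono hw') (hg.mono (hw.trans hw')) hv'))))

theorem cpt_isRep (hN : Bounding N) (hf : CptI N w f) : CptPI N w fun x σ => x.1.IsRep (f x σ) :=
  CptP.all cpt_n (fun x _ => hN.n_le x) fun _ hw _ hv => CptP.imp (CptP.lt hv (hf.mono hw))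
    (CptP.not (cpt_same hN hv (hf.mono hw)))

theorem cpt_cls (hN : Bounding N) (hf : CptI N w f) : CptI N w fun x σ => x.1.cls (f x σ) :=
  Cpt.card_filter cpt_n (fun x _ => hN.n_le x) fun _ hw _ hv => CptP.and (cpt_isRep hN hv)
    (CptP.ex cpt_n (fun x _ => hN.n_le x) fun _ hw' _ hv' => CptP.and (cpt_isRep hN hv')
      (CptP.and (cpt_same hN hv' (hf.mono (hw.trans hw'))) (CptP.lt (hv.mono hw') hv')))

theorem cpt_member (hN : Bounding N) (hf : CptI N w f) : CptI N w fun x σ => x.1.member (f x σ) :=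
  Cpt.find cpt_n (fun x _ => hN.n_le x) fun _ hw _ hv => CptP.eq (cpt_cls hN hv) (hf.mono hw)

theorem cpt_classSize (hN : Bounding N) (hf : CptI N w f) :
    CptI N w fun x σ => x.1.classSize (f x σ) :=
  Cpt.card_filter cpt_n (fun x _ => hN.n_le x) fun _ hw _ hv =>
    CptP.eq (cpt_cls hN hv) (hf.mono hw)

theorem cpt_rank (hN : Bounding N) (hf : CptI N w f) : CptI N w fun x σ => x.1.rank (f x σ) :=
  Cpt.card_filter cpt_n (fun x _ => hN.n_le x) fun _ hw _ hv =>
    CptP.and (CptP.eq (cpt_cls hN hv) (cpt_cls hN (hf.mono hw)))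
      (CptP.or (CptP.lt (cpt_rel hv) (cpt_rel (hf.mono hw)))
        (CptP.and (CptP.eq (cpt_rel hv) (cpt_rel (hf.mono hw))) (CptP.lt hv (hf.mono hw))))

theorem cpt_classBound (hN : Bounding N) : CptI N w fun x _ => x.1.classBound κ :=
  Cpt.mul (Cpt.mul (Cpt.lit κ) cpt_m fun x _ => hN.m_le x) cpt_m fun x _ => hN.m_le x

theorem Bounding.classBound_le (hN : Bounding N) (x : {I // Restricted m κ p L I}) :
    x.1.classBound κ ≤ N x := (hN.bounds x).2.2.2.1

theorem cpt_onPath (hf : CptI N w f) (hg : CptI N w g) :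
    CptPI N w fun x σ => x.1.OnPath (f x σ) (g x σ) :=
  CptP.or (CptP.and (CptP.le (cpt_st hf) hg) (CptP.le hg (cpt_tg hf)))
    (CptP.and (CptP.le (cpt_tg hf) hg) (CptP.le hg (cpt_st hf)))

theorem cpt_follows (hf : CptI N w f) (hg : CptI N w g) (hh : CptI N w h) :
    CptPI N w fun x σ => x.1.Follows (f x σ) (g x σ) (h x σ) :=
  CptP.and (cpt_onPath hf hg) (CptP.and (cpt_onPath hf hh) (CptP.or
    (CptP.and (cpt_rt hf) (CptP.eq hh (hg.add (Cpt.lit 1))))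
    (CptP.and (CptP.not (cpt_rt hf)) (CptP.eq hg (hh.add (Cpt.lit 1))))))

theorem cpt_gap (hN : Bounding N) (hf : CptI N w f) (hg : CptI N w g) (hh : CptI N w h) :
    CptI N w fun x σ => x.1.gap p (f x σ) (g x σ) (h x σ) :=
  Cpt.ite (CptP.iff (cpt_rt hf) (cpt_rt hg)) (Cpt.lit p)
    (Cpt.ite (cpt_adjN hN.n_le hh hf hg) (Cpt.lit 0) ((Cpt.lit p).add (cpt_tr hh)))

theorem cpt_digits (hN : Bounding N) : CptI N w fun x _ => x.1.digits κ L :=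
  Cpt.mul (Cpt.mul (cpt_classBound hN) cpt_m fun x _ => hN.m_le x) (Cpt.lit (L + 1))
    fun x _ => (hN.bounds x).2.2.2.2.2.2.2.2.2.2

theorem Bounding.states_le (hN : Bounding N) (x : {I // Restricted m κ p L I}) :
    x.1.states κ L ≤ N x := (hN.bounds x).2.2.2.2.2.2.2.1

theorem cpt_states (hN : Bounding N) : CptI N w fun x _ => x.1.states κ L :=
  Cpt.pow (cpt_n.add (Cpt.lit 1)) (fun x _ => (hN.bounds x).1) (cpt_digits hN)
    fun x _ => (hN.bounds x).2.2.2.2.1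

theorem cpt_digit (hN : Bounding N) (hf : CptI N w f) (hg : CptI N w g) (hh : CptI N w h)
    (hk : CptI N w k) : CptI N w fun x σ => x.1.digit κ L (f x σ) (g x σ) (h x σ) (k x σ) := by
  have hN' := fun x => hN.bounds x
  refine Cpt.mod (Cpt.div (hf.min ((cpt_states hN).sub (Cpt.lit 1)))
    (fun x _ => (min_le_right _ _).trans ((Nat.sub_le _ _).trans (hN.states_le x))) (Cpt.pow (cpt_n.add (Cpt.lit 1))
    (fun x _ => (hN' x).1) (Cpt.min (Cpt.add (Cpt.mul (Cpt.add (hg.mul cpt_m fun x _ => hN.m_le x) hh)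
      (Cpt.lit (L + 1)) fun x _ => (hN' x).2.2.2.2.2.2.2.2.2.2) hk) (cpt_digits hN))
    (fun x _ => (min_le_right _ _).trans (hN' x).2.2.2.2.1)) ?_) ?_ (cpt_n.add (Cpt.lit 1))
    (fun x _ => (hN' x).1)
  · exact fun x σ => le_trans (Nat.pow_le_pow_right (Nat.succ_pos _) (min_le_right _ _))
      (hN.states_le x)
  · exact fun x σ => (Nat.div_le_self _ _).trans ((min_le_right _ _).trans
      ((Nat.sub_le _ _).trans (hN.states_le x)))

theorem cpt_valid (hN : Bounding N) (hf : CptI N w f) (hg : CptI N w g) (hh : CptI N w h) :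
    CptPI N w fun x σ => x.1.Valid κ p L (f x σ) (g x σ) (h x σ) := by
  have hC : ∀ w, CptI N w fun x _ => x.1.classBound κ := fun w => cpt_classBound hN
  have hCle : ∀ (x : {I // Restricted m κ p L I}) (_ : Store), x.1.classBound κ ≤ N x :=
    fun x _ => hN.classBound_le x
  have hmle : ∀ (x : {I // Restricted m κ p L I}) (_ : Store), x.1.m ≤ N x := fun x _ => hN.m_le x
  have hz : ∀ w, CptI N w fun _ _ => 0 := fun w => Cpt.lit 0
  refine CptP.and ?_ (CptP.and ?_ (CptP.and ?_ ?_))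
  · refine CptP.all (hC _) hCle fun w₁ h₁ c hc => CptP.all cpt_m hmle fun w₂ h₂ i hi => CptP.and ?_ ?_
    · exact CptP.all (Cpt.lit L) (fun x _ => (hN.bounds x).2.2.2.2.2.1) fun w₃ h₃ k hk =>
        CptP.eq (cpt_digit hN (hh.mono (by omega)) (hc.mono (by omega)) (hi.mono h₃)
          (hk.add (Cpt.lit 1)))
          (cpt_digit hN (hg.mono (by omega)) (hc.mono (by omega)) (hi.mono h₃) hk)
    · exact CptP.le (cpt_digit hN (hg.mono (by omega)) (hc.mono h₂) hi (hz _))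
        (cpt_digit hN (hh.mono (by omega)) (hc.mono h₂) hi (hz _))
  · exact CptP.all (hC _) hCle fun w₁ h₁ c hc => CptP.le (cpt_digit hN (hh.mono h₁) hc
      (cpt_st (cpt_member hN hc)) (hz _)) (Cpt.card_filter cpt_n (fun x _ => hN.n_le x)
      fun w₂ h₂ j hj => CptP.and (CptP.eq (cpt_cls hN hj) (hc.mono h₂))
        (CptP.le (cpt_rel hj) (cpt_slot hN (hf.mono (by omega)))))
  · exact CptP.all (hC _) hCle fun w₁ h₁ c hc => CptP.all cpt_m hmle fun w₂ h₂ i hi =>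
      CptP.all cpt_m hmle fun w₃ h₃ i' hi' => CptP.imp
        (cpt_follows (cpt_member hN (hc.mono (by omega))) (hi.mono h₃) hi')
        (CptP.le (cpt_digit hN (hh.mono (by omega)) (hc.mono (by omega)) hi' (hz _))
          (cpt_digit hN (hh.mono (by omega)) (hc.mono (by omega)) (hi.mono h₃)
            ((Cpt.lit p).add (cpt_tr (hi.mono h₃)))))
  · refine CptP.all (hC _) hCle fun w₁ h₁ c hc => CptP.all (hC _) hCle fun w₂ h₂ c' hc' =>
      CptP.all cpt_m hmle fun w₃ h₃ i hi => ?_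
    have hc₃ := hc.mono (show w₁ ≤ w₃ by omega)
    have hc₃' := hc'.mono h₃
    have hh₃ := hh.mono (show w ≤ w₃ by omega)
    have hgap := cpt_gap hN (cpt_member hN hc₃) (cpt_member hN hc₃') hi
    exact CptP.imp (cpt_onPath (cpt_member hN hc₃) hi) (CptP.imp
      (cpt_onPath (cpt_member hN hc₃') hi) (CptP.and
      (CptP.imp (CptP.ne hc₃ hc₃') (CptP.or
        (CptP.le (cpt_digit hN hh₃ hc₃ hi (hz _)) (cpt_digit hN hh₃ hc₃ hi hgap))
        (CptP.le (cpt_digit hN hh₃ hc₃' hi (hz _)) (cpt_digit hN hh₃ hc₃' hi hgap))))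
      (CptP.imp (CptP.eq hc₃ hc₃') (CptP.le (cpt_digit hN hh₃ hc₃ hi (hz _))
        ((cpt_digit hN hh₃ hc₃ hi hgap).add (Cpt.lit 1))))))

theorem cpt_big (hN : Bounding N) : CptI N w fun x _ => x.1.big L :=
  (Cpt.mul (cpt_slot hN (cpt_slots hN)) cpt_n fun x _ => hN.n_le x).add (Cpt.lit 1)

theorem cpt_stepCost (hN : Bounding N) (hf : CptI N w f) (hg : CptI N w g) :
    CptI N w fun x σ => x.1.stepCost κ L (f x σ) (g x σ) := by
  refine Cpt.sum (cpt_classBound hN) (fun x _ => hN.classBound_le x) fun w₁ h₁ c hc =>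
    Cpt.mul (cpt_slot hN (hf.mono h₁)) (Cpt.sub
      (cpt_digit hN (hg.mono h₁) hc (cpt_tg (cpt_member hN hc)) (Cpt.lit 0))
      (cpt_digit hN (hg.mono h₁) hc (cpt_tg (cpt_member hN hc)) (Cpt.lit 1))) fun x σ => ?_
  refine (Nat.sub_le _ _).trans (le_trans (Nat.le_of_lt ?_) (hN.bounds x).1)
  exact Nat.mod_lt _ (Nat.succ_pos _)

theorem cpt_weight (hN : Bounding N) (hf : CptI N w f) (hg : CptI N w g) (hh : CptI N w h) :
    CptI N w fun x σ => x.1.weight κ p L (f x σ) (g x σ) (h x σ) :=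
  Cpt.ite (cpt_valid hN hf hg hh) (cpt_stepCost hN hf hh) (cpt_big hN)

theorem cpt_finalWeight (hN : Bounding N) (hf : CptI N w f) :
    CptI N w fun x σ => x.1.finalWeight κ L (f x σ) :=
  Cpt.ite (CptP.all (cpt_classBound hN) (fun x _ => hN.classBound_le x) fun w₁ h₁ c hc =>
    CptP.all cpt_m (fun x _ => hN.m_le x) fun w₂ h₂ i hi => CptP.imp
      (cpt_onPath (cpt_member hN (hc.mono h₂)) hi)
      (CptP.eq (cpt_digit hN (hf.mono (by omega)) (hc.mono h₂) hi (Cpt.lit 0))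
        (cpt_classSize hN (hc.mono h₂)))) (Cpt.lit 0) (cpt_big hN)

theorem minN_congr {g g' : ℕ → ℕ} {b : ℕ} (hb : 0 < b) (h : ∀ k < b, g k = g' k) :
    minN g b = minN g' b := by
  apply le_antisymm
  · obtain ⟨k, hk, he⟩ := exists_minN_eq g' hb
    rw [he, ← h k hk]; exact minN_le _ hk
  · obtain ⟨k, hk, he⟩ := exists_minN_eq g hb
    rw [he, h k hk]; exact minN_le _ hk

theorem Instance.states_pos (I : Instance) (κ L : ℕ) : 0 < I.states κ L :=
  Nat.pow_pos (Nat.succ_pos _)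

/-- The values of the dynamic program by course-of-values recursion over a table. -/
theorem tabRec_eq_value (I : Instance) (κ p L r x : ℕ) (hx : x < I.states κ L) {b : ℕ}
    (hb : r * I.states κ L + x < b) :
    -- The values are stored row by row, that of `r` and `x` in cell `r * I.states κ L + x`; a row
    -- refers to the preceding one only.
    tabRec (fun z A => if z / I.states κ L = 0 then I.finalWeight κ L (z % I.states κ L) else
      minN (fun y => I.weight κ p L (I.slots L - z / I.states κ L) (z % I.states κ L) y +
        A ((z / I.states κ L - 1) * I.states κ L + y)) (I.states κ L)) b
      (r * I.states κ L + x) = I.value κ p L r x := by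
  have hdiv : ∀ r x, x < I.states κ L → (r * I.states κ L + x) / I.states κ L = r := fun r x hx => by
    rw [mul_comm, Nat.mul_add_div (I.states_pos κ L), Nat.div_eq_of_lt hx, add_zero]
  have hmod : ∀ r x, x < I.states κ L → (r * I.states κ L + x) % I.states κ L = x := fun r x hx => by
    rw [mul_comm, Nat.mul_add_mod, Nat.mod_eq_of_lt hx]
  induction r generalizing x b with
  | zero =>
    rw [tabRec_of_lt _ hb]
    rw [hdiv _ _ hx, hmod _ _ hx, if_pos rfl, Instance.value]
  | succ r ih =>
    rw [tabRec_of_lt _ hb]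
    rw [hdiv _ _ hx, hmod _ _ hx, if_neg (by omega), Instance.value]
    refine minN_congr (I.states_pos κ L) fun y hy => ?_
    rw [Nat.add_sub_cancel, ih y hy]
    rw [Nat.succ_mul]
    omega

theorem Instance.digit_clamp (I : Instance) (κ L x : ℕ) :
    I.digit κ L (min x (I.states κ L - 1)) = I.digit κ L x := by
  funext c i k
  simp [Instance.digit]

/-- A state matters only through its digits, which ignore the cap. Therefore `cpt_value` may cap the
state in order to stay inside the row of the table. -/
theorem Instance.value_clamp (I : Instance) (κ p L r x : ℕ) :
    I.value κ p L r (min x (I.states κ L - 1)) = I.value κ p L r x := by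
  classical
  have hF : I.Final κ L (min x (I.states κ L - 1)) = I.Final κ L x := by
    unfold Instance.Final; rw [I.digit_clamp]
  have hV : ∀ q, I.Valid κ p L q (min x (I.states κ L - 1)) = I.Valid κ p L q x := fun q => by
    unfold Instance.Valid; rw [I.digit_clamp]
  have hW : ∀ q, I.weight κ p L q (min x (I.states κ L - 1)) = I.weight κ p L q x := fun q =>
    funext fun y => if_congr (iff_of_eq (congrFun (hV q) y)) rfl rfl
  cases r with
  | zero => exact if_congr (iff_of_eq hF) rfl rfl
  | succ r => rw [Instance.value, Instance.value, hW]

theorem cpt_value (hN : Bounding N) (hf : CptI N w f) (hg : CptI N w g)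
    (hfs : ∀ x σ, f x σ ≤ x.1.slots L) :
    CptI N w fun x σ => x.1.value κ p L (f x σ) (g x σ) := by
  have hb : ∀ w, CptI N w fun x _ => x.1.states κ L * (x.1.slots L + 1) := fun w =>
    (Cpt.mul ((cpt_slots hN).add (Cpt.lit 1)) (cpt_states hN) fun x _ => hN.states_le x).congr
      fun x _ => mul_comm _ _
  have hbN : ∀ x : {I // Restricted m κ p L I}, x.1.states κ L * (x.1.slots L + 1) ≤ N x :=
    fun x => (hN.bounds x).2.2.2.2.2.2.2.2.1
  have hP : ∀ w, CptI N w fun x _ => x.1.states κ L := fun w => cpt_states hN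
  have hPN : ∀ (x : {I // Restricted m κ p L I}) (_ : Store), x.1.states κ L ≤ N x :=
    fun x _ => hN.states_le x
  have key := Cpt.tab (G := fun (x : {I // Restricted m κ p L I}) _ z' A =>
      (fun z => if z / x.1.states κ L = 0 then x.1.finalWeight κ L (z % x.1.states κ L) else
        minN (fun y => x.1.weight κ p L (x.1.slots L - z / x.1.states κ L) (z % x.1.states κ L) y +
          A ((z / x.1.states κ L - 1) * x.1.states κ L + y)) (x.1.states κ L))
        -- The cap bounds the arguments of division at every `z'`. The cells of the table lie below
        -- it, so `hcongr` removes it again.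
        (min z' (x.1.states κ L * (x.1.slots L + 1))))
    (hb w) (fun x _ => (hbN x).trans (Nat.le_succ _)) (fun _ _ _ _ => rfl) ?_
    ((hf.mul (hP w) hPN).add (hg.min ((hP w).sub (Cpt.lit 1))))
  · refine key.congr fun x σ => ?_
    have hpos := x.1.states_pos κ L
    have hlt : f x σ * x.1.states κ L + min (g x σ) (x.1.states κ L - 1) <
        x.1.states κ L * (x.1.slots L + 1) := by
      have := Nat.mul_le_mul_right (x.1.states κ L) (hfs x σ)
      rw [mul_add, mul_one, mul_comm (x.1.states κ L)]
      omega
    have hcongr : ∀ (G G' : ℕ → (ℕ → ℕ) → ℕ) (b : ℕ), (∀ k < b, G k = G' k) →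
        tabRec G b = tabRec G' b := by
      intro G G' b h
      induction b with
      | zero => rfl
      | succ b ih => rw [tabRec, tabRec, ih fun k hk => h k (by omega), h b (by omega)]
    rw [← Instance.value_clamp, ← tabRec_eq_value x.1 κ p L (f x σ) _ (by omega) hlt]
    refine congrFun (hcongr _ _ _ fun k hk => ?_) _
    funext A
    rw [min_eq_left hk.le]
  · intro w₁ h₁ z A hz hA
    have hz' := hz.min (hb w₁)
    have hz'N : ∀ (x : {I // Restricted m κ p L I}) (σ : Store),
        min (z x σ) (x.1.states κ L * (x.1.slots L + 1)) ≤ N x :=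
      fun x σ => (min_le_right _ _).trans (hbN x)
    have hdiv := hz'.div hz'N (hP w₁) hPN
    have hmod := hz'.mod hz'N (hP w₁) hPN
    exact Cpt.ite_zero hdiv (cpt_finalWeight hN hmod) (Cpt.minimum (hP w₁) hPN fun w₂ h₂ y hy =>
      (cpt_weight hN ((cpt_slots hN).sub (hdiv.mono h₂)) (hmod.mono h₂) hy).add
        (hA w₂ h₂ _ ((((hdiv.mono h₂).sub (Cpt.lit 1)).mul (hP w₂) hPN).add hy)))

theorem cpt_pathState (hN : Bounding N) (hf : CptI N w f) :
    CptI N w fun x σ => x.1.pathState κ p L (f x σ) :=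
  Cpt.iter (Cpt.lit 0) (hf.min (cpt_slots hN)) (fun x _ => (min_le_right _ _).trans (hN.slots_le x))
    fun _ _ _ _ ha hy => Cpt.find (cpt_states hN) (fun x _ => hN.states_le x)
      fun _ h₂ _ hz => CptP.eq
        ((cpt_weight hN (ha.mono h₂) (hy.mono h₂) hz).add
          (cpt_value hN ((cpt_slots hN).sub ((ha.mono h₂).add (Cpt.lit 1))) hz
            fun _ _ => Nat.sub_le _ _))
        (cpt_value hN ((cpt_slots hN).sub (ha.mono h₂)) (hy.mono h₂) fun _ _ => Nat.sub_le _ _)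

theorem cpt_startSlot (hN : Bounding N) (hf : CptI N w f) (hg : CptI N w g) :
    CptI N w fun x σ => x.1.startSlot κ p L (f x σ) (g x σ) :=
  Cpt.card_filter (cpt_slots hN) (fun x _ => hN.slots_le x) fun _ hw _ hv =>
    CptP.le (cpt_digit hN (cpt_pathState hN (hv.add (Cpt.lit 1))) (cpt_cls hN (hf.mono hw))
      (hg.mono hw) (Cpt.lit 0)) (cpt_rank hN (hf.mono hw))

theorem cpt_output (hN : Bounding N) (hf : CptI N w f) :
    CptI N w fun x σ => x.1.output κ p L (f x σ) := by
  have hnm : CptI N w fun x _ => x.1.n * x.1.m := Cpt.mul cpt_n cpt_m fun x _ => hN.m_le x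
  have hle : ∀ (x : {I // Restricted m κ p L I}) (σ : Store), min (f x σ) (x.1.n * x.1.m) ≤ N x :=
    fun x _ => (min_le_right _ _).trans (hN.bounds x).2.2.2.2.2.2.2.2.2.1
  exact cpt_slot hN (cpt_startSlot hN ((hf.min hnm).div hle cpt_m fun x _ => hN.m_le x)
    ((hf.min hnm).mod hle cpt_m fun x _ => hN.m_le x))

theorem exists_polynomial_loopBound (m κ p L : ℕ) : ∃ R : Polynomial ℕ,
    ∀ x : {I // Restricted m κ p L I}, R.eval x.1.n = x.1.loopBound κ L := by
  open Polynomial in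
  let S : Polynomial ℕ := (X * C m * C L + C L + 1) * X + 1
  -- The exponent in the number of states is a constant, because `m`, `κ` and `L` are.
  let D : ℕ := κ * m * m * m * (L + 1)
  refine ⟨(.X + 1) ^ D * (S + 1) + (.X + 1) ^ D + S + .X + .C m + .C (κ * m * m) + .C D + .C L +
    .X * .C m + 1, fun x => ?_⟩
  simp only [S, D, Instance.loopBound, Instance.states, Instance.slots, Instance.digits,
    Instance.classBound, x.2.1, Polynomial.eval_add, Polynomial.eval_mul, Polynomial.eval_pow,
    Polynomial.eval_X, Polynomial.eval_C, Polynomial.eval_one]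

end Computability

/-- The problem is solvable in polynomial time provided that the output is always optimal. -/
theorem polyTimeOn_restricted (m κ p L : ℕ)
    (hopt : ∀ I, Restricted m κ p L I → ∀ out : ℕ → ℕ,
      (∀ k < I.n * I.m, out k = I.output κ p L k) → (I.decodeSchedule out).IsOptimal) :
    PolyTimeOn (Restricted m κ p L) := by
  obtain ⟨R, hR⟩ := exists_polynomial_loopBound m κ p L
  have hN : Bounding (m := m) (κ := κ) (p := p) (L := L) fun x => R.eval x.1.n :=
    fun x => (hR x).ge
  exact solvableInPolyTime_of_cpt (f := fun x => x.1.output κ p L) (n := fun x => x.1.n)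
    (len := fun x => x.1.n * x.1.m) R (fun x => x.1.getD_encode_one) (fun x => x.1.n_le_bitSize)
    (fun w v hv => cpt_output hN hv) (Cpt.mul cpt_n cpt_m fun x _ => hN.m_le x)
    (fun x => (hN.bounds x).2.2.2.2.2.2.2.2.2.1) (fun x out h => hopt x.1 x.2 out h)

namespace Instance

variable {I : Instance} {κ p L : ℕ}

/-! ### Classes -/

theorem Same.refl (j : ℕ) : I.Same j j := ⟨Iff.rfl, rfl, rfl, fun _ _ _ _ => Iff.rfl⟩

theorem Same.symm {j j' : ℕ} (h : I.Same j j') : I.Same j' j :=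
  ⟨h.1.symm, h.2.1.symm, h.2.2.1.symm, fun i hi k hk => (h.2.2.2 i hi k hk).symm⟩

theorem Same.trans {j j' k : ℕ} (h : I.Same j j') (h' : I.Same j' k) : I.Same j k :=
  ⟨h.1.trans h'.1, h.2.1.trans h'.2.1, h.2.2.1.trans h'.2.2.1,
    fun i hi l hl => (h.2.2.2 i hi l hl).trans (h'.2.2.2 i hi l hl)⟩

theorem exists_rep {j : ℕ} (hj : j < I.n) : ∃ k < I.n, I.IsRep k ∧ I.Same k j := by
  classical
  have hex : ∃ k, k < I.n ∧ I.Same k j := ⟨j, hj, Same.refl j⟩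
  exact ⟨Nat.find hex, (Nat.find_spec hex).1, fun k hk hlt hs =>
    Nat.find_min hex hlt ⟨hk, hs.trans (Nat.find_spec hex).2⟩, (Nat.find_spec hex).2⟩

theorem IsRep.eq {j k : ℕ} (hj : j < I.n) (hk : k < I.n) (hrj : I.IsRep j) (hrk : I.IsRep k)
    (h : I.Same j k) : j = k := by
  rcases lt_trichotomy j k with hlt | he | hlt
  · exact absurd h (hrk j hj hlt)
  · exact he
  · exact absurd h.symm (hrj k hk hlt)

open Classical in
theorem cls_eq_card {j k : ℕ} (hk : k < I.n) (hr : I.IsRep k) (hs : I.Same k j) :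
    I.cls j = ((Finset.range I.n).filter fun j' => I.IsRep j' ∧ j' < k).card := by
  unfold cls
  congr 1
  refine Finset.filter_congr fun j' _ => and_congr_right fun _ => ⟨?_, fun h => ⟨k, hk, hr, hs, h⟩⟩
  rintro ⟨k', hk', hr', hs', h⟩
  rwa [← IsRep.eq hk' hk hr' hr (hs'.trans hs.symm)]

theorem same_of_cls_eq {j j' : ℕ} (hj : j < I.n) (hj' : j' < I.n) (h : I.cls j = I.cls j') :
    I.Same j j' := by
  classical
  obtain ⟨k, hk, hr, hs⟩ := exists_rep hj
  obtain ⟨k', hk', hr', hs'⟩ := exists_rep hj'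
  rw [cls_eq_card hk hr hs, cls_eq_card hk' hr' hs'] at h
  -- The number of preceding representatives increases strictly from one representative to a later
  -- one, so it identifies the class.
  have key : ∀ a b, a < I.n → I.IsRep a → a < b →
      ((Finset.range I.n).filter fun j' => I.IsRep j' ∧ j' < a).card <
        ((Finset.range I.n).filter fun j' => I.IsRep j' ∧ j' < b).card := by
    intro a b ha hra hab
    refine Finset.card_lt_card ⟨fun c hc => ?_, fun hsub => ?_⟩
    · simp only [Finset.mem_filter] at hc ⊢
      exact ⟨hc.1, hc.2.1, hc.2.2.trans hab⟩
    · have := hsub (Finset.mem_filter.2 ⟨Finset.mem_range.2 ha, hra, hab⟩)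
      simp at this
  rcases lt_trichotomy k k' with hlt | rfl | hlt
  · exact absurd h (key k k' hk hr hlt).ne
  · exact hs.symm.trans hs'
  · exact absurd h (key k' k hk' hr' hlt).ne'

/-- A representative is determined by its compatibility type, which includes the direction, and by
its start and target. -/
theorem card_rep_le (hκ : I.numTypes ≤ κ) {s : Finset ℕ}
    (hs : ∀ j ∈ s, j < I.n ∧ I.IsRep j) : s.card ≤ I.classBound κ := by
  classical
  let f : {j // j ∈ s} → Set.range I.compatType × Fin I.m × Fin I.m := fun j =>
    (⟨I.compatType ⟨j.1, (hs j.1 j.2).1⟩, Set.mem_range_self _⟩, I.start ⟨j.1, (hs j.1 j.2).1⟩,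
      I.target ⟨j.1, (hs j.1 j.2).1⟩)
  have hf : Function.Injective f := by
    rintro ⟨j, hjs⟩ ⟨k, hks⟩ h
    obtain ⟨hj, hrj⟩ := hs j hjs
    obtain ⟨hk, hrk⟩ := hs k hks
    simp only [f, Prod.mk.injEq, Subtype.mk.injEq, compatType] at h
    obtain ⟨⟨h1, h2⟩, h3, h4⟩ := h
    refine Subtype.ext (IsRep.eq hj hk hrj hrk ⟨?_, ?_, ?_, fun i hi l hl => ?_⟩)
    · simp [rt, hj, hk, h1]
    · simp [st, hj, hk, h3]
    · simp [tg, hj, hk, h4]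
    · have := congrFun h2 ⟨i, hi⟩
      have hl' := Set.ext_iff.1 this ⟨l, hl⟩
      simpa [adjN, hi, hj, hk, hl] using hl'
  have := Nat.card_le_card_of_injective f hf
  rw [Nat.card_eq_fintype_card, Fintype.card_coe, Nat.card_prod, Nat.card_prod, Nat.card_fin,
    Nat.card_coe_set_eq, ← mul_assoc] at this
  refine this.trans ?_
  exact Nat.mul_le_mul_right _ (Nat.mul_le_mul_right _ hκ)

theorem cls_lt (hκ : I.numTypes ≤ κ) {j : ℕ} (hj : j < I.n) : I.cls j < I.classBound κ := by
  classical
  obtain ⟨k, hk, hr, hs⟩ := exists_rep hj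
  rw [cls_eq_card hk hr hs]
  refine lt_of_lt_of_le (Finset.card_lt_card (t := (Finset.range I.n).filter I.IsRep)
    ⟨fun c hc => ?_, fun hsub => ?_⟩) (card_rep_le hκ fun j hj => ?_)
  · simp only [Finset.mem_filter] at hc ⊢
    exact ⟨hc.1, hc.2.1⟩
  · have := hsub (Finset.mem_filter.2 ⟨Finset.mem_range.2 hk, hr⟩)
    simp at this
  · simpa using hj

theorem member_spec {j : ℕ} (hj : j < I.n) :
    I.member (I.cls j) < I.n ∧ I.Same (I.member (I.cls j)) j := by
  have h := findN_spec (p := fun k => I.cls k = I.cls j) ⟨j, hj, rfl⟩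
  exact ⟨h.1, same_of_cls_eq h.1 hj h.2⟩

theorem Same.onPath {j j' : ℕ} (h : I.Same j j') (i : ℕ) : I.OnPath j i ↔ I.OnPath j' i := by
  rw [OnPath, OnPath, h.2.1, h.2.2.1]

theorem Same.follows {j j' : ℕ} (h : I.Same j j') (i i' : ℕ) :
    I.Follows j i i' ↔ I.Follows j' i i' := by
  rw [Follows, Follows, h.onPath, h.onPath, h.1]

theorem adjN_comm (i j j' : ℕ) : I.adjN i j j' ↔ I.adjN i j' j := by
  constructor <;> rintro ⟨hi, hj, hj', h⟩ <;> exact ⟨hi, hj', hj, h.symm⟩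

theorem gap_comm (j j' i : ℕ) : I.gap p j j' i = I.gap p j' j i := by
  classical
  simp only [gap, adjN_comm i j j', iff_comm (a := I.rt j)]

theorem Same.adjN {j j' k k' i : ℕ} (h : I.Same j j') (h' : I.Same k k') (hi : i < I.m)
    (hj' : j' < I.n) (hk : k < I.n) : I.adjN i j k ↔ I.adjN i j' k' := by
  rw [h.2.2.2 i hi k hk, adjN_comm, h'.2.2.2 i hi j' hj', adjN_comm]

theorem Same.gap {j j' k k' i : ℕ} (h : I.Same j j') (h' : I.Same k k') (hi : i < I.m)
    (hj' : j' < I.n) (hk : k < I.n) : I.gap p j k i = I.gap p j' k' i := by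
  classical
  simp only [Instance.gap, h.1, h'.1, h.adjN h' hi hj' hk]

theorem st_lt {j : ℕ} (hj : j < I.n) : I.st j < I.m := by simp [st, hj]

theorem tg_lt {j : ℕ} (hj : j < I.n) : I.tg j < I.m := by simp [tg, hj]

theorem OnPath.lt {j i : ℕ} (hj : j < I.n) (h : I.OnPath j i) : i < I.m := by
  have h1 := st_lt hj
  have h2 := tg_lt hj
  unfold OnPath at h
  omega

theorem onPath_st (j : ℕ) : I.OnPath j (I.st j) := by unfold OnPath; omega

theorem onPath_tg (j : ℕ) : I.OnPath j (I.tg j) := by unfold OnPath; omega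

/-! ### Ranks -/

theorem rank_lt_rank {j k : ℕ} (hj : j < I.n) (h : I.cls j = I.cls k)
    (hlt : I.rel j < I.rel k ∨ I.rel j = I.rel k ∧ j < k) : I.rank j < I.rank k := by
  classical
  refine Finset.card_lt_card ⟨fun l hl => ?_, fun hsub => ?_⟩
  · simp only [Finset.mem_filter] at hl ⊢
    exact ⟨hl.1, hl.2.1.trans h, by omega⟩
  · have := hsub (Finset.mem_filter.2 ⟨Finset.mem_range.2 hj, h, hlt⟩)
    simp at this

theorem rank_ne_rank {j k : ℕ} (hj : j < I.n) (hk : k < I.n) (h : I.cls j = I.cls k) (hne : j ≠ k) :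
    I.rank j ≠ I.rank k := by
  by_cases h' : I.rel j < I.rel k ∨ I.rel j = I.rel k ∧ j < k
  · exact (rank_lt_rank hj h h').ne
  · exact (rank_lt_rank hk h.symm (by omega)).ne'

theorem rank_lt_classSize {j : ℕ} (hj : j < I.n) : I.rank j < I.classSize (I.cls j) := by
  classical
  refine Finset.card_lt_card ⟨fun l hl => ?_, fun hsub => ?_⟩
  · simp only [Finset.mem_filter] at hl ⊢
    exact ⟨hl.1, hl.2.1⟩
  · have := hsub (Finset.mem_filter.2 ⟨Finset.mem_range.2 hj, rfl⟩)
    simp at this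

-- The ranks in a class are distinct and smaller than its size, so they exhaust the numbers below
-- it.
open Classical in
theorem card_rank_lt (c : ℕ) {v : ℕ} (hv : v ≤ I.classSize c) :
    ((Finset.range I.n).filter fun j => I.cls j = c ∧ I.rank j < v).card = v := by
  have himg : ((Finset.range I.n).filter fun j => I.cls j = c).image I.rank =
      Finset.range (I.classSize c) := by
    refine Finset.eq_of_subset_of_card_le (fun r hr => ?_) ?_
    · obtain ⟨j, hj, rfl⟩ := Finset.mem_image.1 hr
      simp only [Finset.mem_filter, Finset.mem_range] at hj ⊢
      rw [← hj.2]
      exact rank_lt_classSize hj.1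
    · rw [Finset.card_range, Finset.card_image_of_injOn, classSize]
      intro j hj k hk he
      simp only [Finset.coe_filter, Finset.mem_range, Set.mem_ofPred_eq] at hj hk
      by_contra hne
      exact rank_ne_rank hj.1 hk.1 (hj.2.trans hk.2.symm) hne he
  have : ((Finset.range I.n).filter fun j => I.cls j = c ∧ I.rank j < v).image I.rank =
      Finset.range v := by
    ext r
    simp only [Finset.mem_image, Finset.mem_filter, Finset.mem_range]
    constructor
    · rintro ⟨j, ⟨_, _, h⟩, rfl⟩; exact h
    · intro hr
      have : r ∈ ((Finset.range I.n).filter fun j => I.cls j = c).image I.rank := by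
        rw [himg]; simp; omega
      obtain ⟨j, hj, rfl⟩ := Finset.mem_image.1 this
      simp only [Finset.mem_filter, Finset.mem_range] at hj
      exact ⟨j, ⟨hj.1, hj.2, hr⟩, rfl⟩
  rw [← Finset.card_image_of_injOn (f := I.rank), this, Finset.card_range]
  intro j hj k hk he
  simp only [Finset.coe_filter, Finset.mem_range, Set.mem_ofPred_eq] at hj hk
  by_contra hne
  exact rank_ne_rank hj.1 hk.1 (hj.2.1.trans hk.2.1.symm) hne he

open Classical in
/-- If more than `rank j` jobs of the class of `j` are released by time `t`, so is `j`. -/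
theorem rel_le_of_rank_lt {j t : ℕ}
    (h : I.rank j < ((Finset.range I.n).filter fun k => I.cls k = I.cls j ∧ I.rel k ≤ t).card) :
    I.rel j ≤ t := by
  by_contra hlt
  -- If `j` is not released, all released jobs of its class precede it in the order by release
  -- dates, and these are at most `rank j` many.
  refine absurd h (not_lt.2 (Finset.card_le_card fun k hk => ?_))
  simp only [Finset.mem_filter] at hk ⊢
  exact ⟨hk.1, hk.2.1, Or.inl (by omega)⟩

end Instance

/-! ### Digits -/

theorem sum_mul_pow_lt {B : ℕ} (v : ℕ → ℕ) (hv : ∀ d, v d < B) (D : ℕ) :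
    ∑ d ∈ Finset.range D, v d * B ^ d < B ^ D := by
  induction D with
  | zero => simp
  | succ D ih =>
    rw [Finset.sum_range_succ, pow_succ, mul_comm (B ^ D)]
    have := Nat.mul_le_mul_right (B ^ D) (hv D)
    rw [Nat.succ_mul] at this
    omega

theorem sum_mul_pow_div_mod {B : ℕ} (v : ℕ → ℕ) (hv : ∀ d, v d < B) {D d : ℕ} (hd : d < D) :
    (∑ e ∈ Finset.range D, v e * B ^ e) / B ^ d % B = v d := by
  induction D generalizing v d with
  | zero => omega
  | succ D ih =>
    have hs : ∑ e ∈ Finset.range (D + 1), v e * B ^ e =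
        v 0 + B * ∑ e ∈ Finset.range D, v (e + 1) * B ^ e := by
      rw [Finset.sum_range_succ', Finset.mul_sum, add_comm, pow_zero, mul_one]
      congr 1
      exact Finset.sum_congr rfl fun e _ => by ring
    rw [hs]
    cases d with
    | zero => rw [pow_zero, Nat.div_one, Nat.add_mul_mod_self_left, Nat.mod_eq_of_lt (hv 0)]
    | succ d =>
      rw [pow_succ', ← Nat.div_div_eq_div_mul, Nat.add_mul_div_left _ _ (by have := hv 0; omega),
        Nat.div_eq_of_lt (hv 0), zero_add]
      exact ih (fun e => v (e + 1)) (fun e => hv _) (by omega)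

namespace Instance

variable {I : Instance} {κ p L : ℕ}

theorem digit_zero (c i k : ℕ) : I.digit κ L 0 c i k = 0 := by simp [digit]

/-- Every choice of the digits belongs to a state. -/
theorem exists_state (w : ℕ → ℕ → ℕ → ℕ) (hw : ∀ c i k, w c i k ≤ I.n) : ∃ x < I.states κ L,
    -- Sequences of states begin with the number `0`, so agreement of the digits would not be
    -- enough.
    ((∀ c i k, w c i k = 0) → x = 0) ∧
    ∀ c < I.classBound κ, ∀ i < I.m, ∀ k ≤ L, I.digit κ L x c i k = w c i k := by
  let v : ℕ → ℕ := fun d => w (d / (L + 1) / I.m) (d / (L + 1) % I.m) (d % (L + 1))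
  have hv : ∀ d, v d < I.n + 1 := fun d => Nat.lt_succ_of_le (hw _ _ _)
  have hlt : ∑ d ∈ Finset.range (I.digits κ L), v d * (I.n + 1) ^ d < I.states κ L :=
    sum_mul_pow_lt v hv (I.digits κ L)
  refine ⟨∑ d ∈ Finset.range (I.digits κ L), v d * (I.n + 1) ^ d, hlt, fun h => ?_,
    fun c hc i hi k hk => ?_⟩
  · simp [v, h]
  · have hd : (c * I.m + i) * (L + 1) + k < I.digits κ L := by
      have h1 : (c + 1) * I.m ≤ I.classBound κ * I.m := Nat.mul_le_mul_right _ hc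
      have h2 : c * I.m + i + 1 ≤ I.classBound κ * I.m := by rw [Nat.succ_mul] at h1; omega
      have h3 := Nat.mul_le_mul_right (L + 1) h2
      rw [Nat.succ_mul] at h3
      unfold digits
      omega
    have hq : ((c * I.m + i) * (L + 1) + k) / (L + 1) = c * I.m + i := by
      rw [mul_comm, Nat.mul_add_div (by omega), Nat.div_eq_of_lt (by omega), add_zero]
    have hr : ((c * I.m + i) * (L + 1) + k) % (L + 1) = k := by
      rw [mul_comm, Nat.mul_add_mod, Nat.mod_eq_of_lt (by omega)]
    have hq' : (c * I.m + i) / I.m = c := by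
      rw [mul_comm, Nat.mul_add_div (by omega), Nat.div_eq_of_lt hi, add_zero]
    have hr' : (c * I.m + i) % I.m = i := by
      rw [mul_comm, Nat.mul_add_mod, Nat.mod_eq_of_lt hi]
    unfold digit
    rw [min_eq_left hd.le, min_eq_left (Nat.le_sub_one_of_lt hlt), sum_mul_pow_div_mod v hv hd]
    simp only [v, hq, hr, hq', hr']

/-- Start times in slots, or in points of time if `θ` is the identity, that satisfy all
constraints. -/
structure Timetable (I : Instance) (p : ℕ) (θ : ℕ → ℕ) (u : ℕ → ℕ → ℕ) : Prop where
  release : ∀ j < I.n, I.rel j ≤ θ (u j (I.st j))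
  travel : ∀ j < I.n, ∀ i i', I.Follows j i i' → u j i + (p + I.tr i) ≤ u j i'
  conflict : ∀ j < I.n, ∀ j' < I.n, j ≠ j' → ∀ i, I.OnPath j i → I.OnPath j' i →
    u j i + I.gap p j j' i ≤ u j' i ∨ u j' i + I.gap p j j' i ≤ u j i

theorem gap_le (hL : ∀ i < I.m, p + I.tr i ≤ L) {j j' i : ℕ} (hi : i < I.m) :
    I.gap p j j' i ≤ L := by
  have := hL i hi
  unfold gap
  split_ifs <;> omega

open Classical in
/-- The cost of a sequence of states whose digits count the jobs of a timetable. -/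
theorem sum_stepCost (hκ : I.numTypes ≤ κ) {z : ℕ → ℕ} {t : ℕ → ℕ}
    (ht : ∀ j < I.n, t j < I.slots L)
    (h0 : ∀ c < I.classBound κ, ∀ a ≤ I.slots L, I.digit κ L (z a) c (I.tg (I.member c)) 0 =
      ((Finset.range I.n).filter fun j => I.cls j = c ∧ t j < a).card)
    (h1 : ∀ c < I.classBound κ, ∀ a < I.slots L, I.digit κ L (z (a + 1)) c (I.tg (I.member c)) 1 =
      I.digit κ L (z a) c (I.tg (I.member c)) 0) :
    ∑ a ∈ Finset.range (I.slots L), I.stepCost κ L a (z (a + 1)) =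
      ∑ j ∈ Finset.range I.n, I.slot L (t j) := by
  have hstep : ∀ a ∈ Finset.range (I.slots L), I.stepCost κ L a (z (a + 1)) =
      ∑ j ∈ Finset.range I.n, if t j = a then I.slot L a else 0 := by
    intro a ha
    rw [Finset.mem_range] at ha
    have hc : ∀ c ∈ Finset.range (I.classBound κ), I.slot L a *
        (I.digit κ L (z (a + 1)) c (I.tg (I.member c)) 0 -
          I.digit κ L (z (a + 1)) c (I.tg (I.member c)) 1) =
        ∑ j ∈ Finset.range I.n, if I.cls j = c then (if t j = a then I.slot L a else 0) else 0 := by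
      intro c hc
      rw [Finset.mem_range] at hc
      rw [h1 c hc a ha, h0 c hc _ ha, h0 c hc _ ha.le]
      have hsplit : ((Finset.range I.n).filter fun j => I.cls j = c ∧ t j < a + 1).card =
          ((Finset.range I.n).filter fun j => I.cls j = c ∧ t j < a).card +
          ((Finset.range I.n).filter fun j => I.cls j = c ∧ t j = a).card := by
        rw [← Finset.card_union_of_disjoint]
        · congr 1
          ext j
          simp only [Finset.mem_filter, Finset.mem_union]
          have : t j < a + 1 ↔ t j < a ∨ t j = a := by omega
          tauto
        · rw [Finset.disjoint_filter]
          intro j _ h h'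
          omega
      rw [hsplit, Nat.add_sub_cancel_left, Finset.card_filter, Finset.mul_sum]
      refine Finset.sum_congr rfl fun j _ => ?_
      by_cases h : I.cls j = c <;> by_cases h' : t j = a <;> simp [h, h']
    rw [stepCost, Finset.sum_congr rfl hc, Finset.sum_comm]
    refine Finset.sum_congr rfl fun j hj => ?_
    rw [Finset.sum_ite_eq, if_pos (Finset.mem_range.2 (cls_lt hκ (Finset.mem_range.1 hj)))]
  rw [Finset.sum_congr rfl hstep, Finset.sum_comm]
  refine Finset.sum_congr rfl fun j hj => ?_
  rw [Finset.sum_ite_eq, if_pos (Finset.mem_range.2 (ht j (Finset.mem_range.1 hj)))]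

/-! ### Slots -/

/-- Stretches of active points begin at release dates only (or at time `0` if there are no jobs).
Hence the first active point after an inactive one is the least later release date, which exists
because otherwise all jobs would be released. -/
theorem nextActive_spec (t : ℕ) : I.Active L (I.nextActive L t) ∧ t ≤ I.nextActive L t ∧
    ∀ s, t ≤ s → I.Active L s → I.nextActive L t ≤ s := by
  classical
  by_cases h : I.Active L t
  · rw [nextActive, if_pos h]
    exact ⟨h, le_rfl, fun s hs _ => hs⟩
  · rw [nextActive, if_neg h]
    have hex : ∃ j ∈ (Finset.range I.n).filter fun j => t < I.rel j, ∀ j' ∈ (Finset.range I.n).filter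
        fun j => t < I.rel j, I.rel j ≤ I.rel j' := by
      refine Finset.exists_min_image _ _ ?_
      by_contra hne
      refine h (Or.inr fun j hj => not_lt.1 fun hlt => hne ⟨j, ?_⟩)
      simp [hj, hlt]
    obtain ⟨j, hj, hmin⟩ := hex
    simp only [Finset.mem_filter, Finset.mem_range] at hj hmin
    obtain ⟨h1, h2, h3⟩ := findN_spec
      (p := fun j => t < I.rel j ∧ ∀ j' < I.n, t < I.rel j' → I.rel j ≤ I.rel j')
      ⟨j, hj.1, hj.2, fun j' hj' hlt => hmin j' ⟨hj', hlt⟩⟩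
    refine ⟨Or.inl ⟨_, h1, le_rfl, by omega⟩, h2.le, fun s hs hact => ?_⟩
    by_contra hlt
    rcases hact with ⟨j', hj', hr, hr'⟩ | hall
    · by_cases ht : t < I.rel j'
      · have := h3 j' hj' ht
        omega
      · exact h (Or.inl ⟨j', hj', by omega, by omega⟩)
    · have := hall _ h1
      omega

theorem slot_zero : I.slot L 0 = I.nextActive L 0 := by
  rw [slot, Nat.zero_min]; rfl

theorem slot_succ {q : ℕ} (h : q < I.slots L) :
    I.slot L (q + 1) = I.nextActive L (I.slot L q + 1) := by
  rw [slot, slot, min_eq_left h, min_eq_left h.le]; rfl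

theorem slot_lt_succ {q : ℕ} (h : q < I.slots L) : I.slot L q < I.slot L (q + 1) := by
  rw [slot_succ h]
  exact (nextActive_spec _).2.1

theorem slot_mono : Monotone (I.slot L) := by
  refine monotone_nat_of_le_succ fun q => ?_
  by_cases h : q < I.slots L
  · exact (slot_lt_succ h).le
  · rw [slot, slot, min_eq_right (by omega), min_eq_right (by omega)]

theorem add_le_slot_add {q d : ℕ} (h : q + d ≤ I.slots L) :
    I.slot L q + d ≤ I.slot L (q + d) := by
  induction d with
  | zero => simp
  | succ d ih =>
    have h1 := ih (by omega)
    have h2 := slot_lt_succ (I := I) (L := L) (q := q + d) (by omega)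
    rw [← add_assoc q d 1]
    omega

theorem count_eq_count {P : ℕ → Prop} [DecidablePred P] {a b : ℕ} (hab : a ≤ b)
    (h : ∀ t, a ≤ t → t < b → ¬ P t) : Nat.count P b = Nat.count P a := by
  induction b, hab using Nat.le_induction with
  | base => rfl
  | succ b hb ih =>
    rw [Nat.count_succ, if_neg (h b hb (Nat.lt_succ_self b)), add_zero]
    exact ih fun t h1 h2 => h t h1 (by omega)

-- Between consecutive slots there is no active point. So the number of a slot counts the active
-- points before it, and `Nat.count` inverts `slot`.
open Classical in
theorem count_slot {q : ℕ} (h : q ≤ I.slots L) : Nat.count (I.Active L) (I.slot L q) = q := by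
  have key : ∀ t, Nat.count (I.Active L) (I.nextActive L t) = Nat.count (I.Active L) t := fun t =>
    count_eq_count (nextActive_spec t).2.1 fun s hs hlt hact =>
      absurd ((nextActive_spec t).2.2 s hs hact) (by omega)
  induction q with
  | zero => rw [slot_zero, key, Nat.count_zero]
  | succ q ih =>
    have hact : I.Active L (I.slot L q) := by
      cases q with
      | zero => rw [slot_zero]; exact (nextActive_spec _).1
      | succ q => rw [slot_succ (by omega)]; exact (nextActive_spec _).1
    rw [slot_succ (by omega), key, Nat.count_succ, if_pos hact, ih (by omega)]

theorem active_slot {q : ℕ} (h : q ≤ I.slots L) : I.Active L (I.slot L q) := by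
  cases q with
  | zero => rw [slot_zero]; exact (nextActive_spec _).1
  | succ q => rw [slot_succ (by omega)]; exact (nextActive_spec _).1

open Classical in
theorem slot_count {t : ℕ} (ht : I.Active L t) (hle : Nat.count (I.Active L) t ≤ I.slots L) :
    I.slot L (Nat.count (I.Active L) t) = t :=
  Nat.count_injective (active_slot hle) ht (count_slot hle)

theorem active_rel_add {j k : ℕ} (hj : j < I.n) (hk : k ≤ I.n * I.m * L + L) :
    I.Active L (I.rel j + k) :=
  Or.inl ⟨j, hj, Nat.le_add_right _ _, by omega⟩

open Classical in
theorem count_rel_add_lt {j k : ℕ} (hj : j < I.n) (hk : k ≤ I.n * I.m * L + L) :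
    Nat.count (I.Active L) (I.rel j + k) < I.slots L := by
  rw [Nat.count_eq_card_filter_range, slots, Nat.lt_succ_iff]
  have hsub : (Finset.range (I.rel j + k)).filter (I.Active L) ⊆ (Finset.range I.n).biUnion
      fun j' => Finset.Icc (I.rel j') (I.rel j' + (I.n * I.m * L + L)) := by
    intro t ht
    simp only [Finset.mem_filter, Finset.mem_range, Finset.mem_biUnion, Finset.mem_Icc] at ht ⊢
    obtain ⟨hlt, ⟨j', hj', h⟩ | hall⟩ := ht
    · exact ⟨j', hj', h⟩
    -- After all release dates, a point before `rel j + k` lies in the stretch that belongs to `j`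
    -- itself.
    · exact ⟨j, hj, hall j hj, by omega⟩
  refine (Finset.card_le_card hsub).trans (Finset.card_biUnion_le.trans ?_)
  refine (Finset.sum_le_sum (g := fun _ => I.n * I.m * L + L + 1) fun j' _ => ?_).trans ?_
  · rw [Nat.card_Icc]; omega
  · rw [Finset.sum_const, Finset.card_range, smul_eq_mul, mul_comm]

-- Here the additional `L` in `Active` is used: the points under consideration are consecutive
-- slots, so that distances up to `L` are the same in time and in slots.
open Classical in
theorem count_rel_add_add {j k d : ℕ} (hj : j < I.n) (hk : k ≤ I.n * I.m * L) (hd : d ≤ L) :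
    Nat.count (I.Active L) (I.rel j + k + d) = Nat.count (I.Active L) (I.rel j + k) + d := by
  induction d with
  | zero => rfl
  | succ d ih =>
    rw [← add_assoc, Nat.count_succ, if_pos, ih (by omega), add_assoc]
    rw [add_assoc]
    exact active_rel_add hj (by omega)

/-! ### From timetables to sequences of states -/

/-- This includes a `j` that is not a job, as `member` may be if there are no jobs. Its start and
target default to `0`, and a class number below the bound forces `0 < I.m`. -/
theorem seg_lt {c j : ℕ} (hc : c < I.classBound κ) : I.st j < I.m ∧ I.tg j < I.m := by
  have hm : 0 < I.m := by
    rcases Nat.eq_zero_or_pos I.m with h | h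
    · simp [classBound, h] at hc
    · exact h
  by_cases hj : j < I.n
  · exact ⟨st_lt hj, tg_lt hj⟩
  · simp [st, tg, hj, hm]

/-- The digit with index `k` before slot `a` counts the jobs with `u j i + k < a`. Constraints on
single jobs turn into inclusions of the sets counted; a violated conflict clause would exhibit two
jobs started too close to each other. -/
theorem exists_states_of_timetable (hκ : I.numTypes ≤ κ) (hL1 : 1 ≤ L)
    (hL : ∀ i < I.m, p + I.tr i ≤ L)
    {u : ℕ → ℕ → ℕ} (hu : I.Timetable p (I.slot L) u)
    (hlt : ∀ j < I.n, ∀ i, I.OnPath j i → u j i < I.slots L) :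
    ∃ z : ℕ → ℕ, (∀ a, z a < I.states κ L) ∧ z 0 = 0 ∧
      (∀ a < I.slots L, I.Valid κ p L a (z a) (z (a + 1))) ∧ I.Final κ L (z (I.slots L)) ∧
      ∑ a ∈ Finset.range (I.slots L), I.stepCost κ L a (z (a + 1)) =
        ∑ j ∈ Finset.range I.n, I.slot L (u j (I.tg j)) := by
  classical
  have hw := fun a => exists_state (I := I) (κ := κ) (L := L)
    (fun c i k => ((Finset.range I.n).filter fun j => I.cls j = c ∧ u j i + k < a).card)
    (fun c i k => (Finset.card_filter_le _ _).trans (Finset.card_range _).le)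
  choose z hz h0 hdig using hw
  have hsame : ∀ j < I.n, I.Same (I.member (I.cls j)) j := fun j hj => (member_spec hj).2
  refine ⟨z, hz, h0 0 fun c i k => by simp, fun a ha => ⟨?_, ?_, ?_, ?_⟩, ?_, ?_⟩
  · refine fun c hc i hi => ⟨fun k hk => ?_, ?_⟩
    · rw [hdig _ c hc i hi _ hk, hdig _ c hc i hi _ hk.le]
      congr 1
      refine Finset.filter_congr fun j _ => and_congr_right fun _ => ?_
      omega
    · rw [hdig _ c hc i hi _ (Nat.zero_le _), hdig _ c hc i hi _ (Nat.zero_le _)]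
      refine Finset.card_le_card fun j hj => ?_
      simp only [Finset.mem_filter] at hj ⊢
      exact ⟨hj.1, hj.2.1, by omega⟩
  · intro c hc
    rw [hdig _ c hc _ (seg_lt hc).1 _ (Nat.zero_le _)]
    refine Finset.card_le_card fun j hj => ?_
    simp only [Finset.mem_filter, Finset.mem_range] at hj ⊢
    obtain ⟨hj, rfl, hlt'⟩ := hj
    rw [(hsame j hj).2.1] at hlt'
    exact ⟨hj, rfl, (hu.release j hj).trans (slot_mono (by omega))⟩
  · intro c hc i hi i' hi' hf
    rw [hdig _ c hc i' hi' _ (Nat.zero_le _), hdig _ c hc i hi _ (hL i hi)]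
    refine Finset.card_le_card fun j hj => ?_
    simp only [Finset.mem_filter, Finset.mem_range] at hj ⊢
    obtain ⟨hj, rfl, hlt'⟩ := hj
    have := hu.travel j hj i i' (((hsame j hj).follows i i').1 hf)
    exact ⟨hj, rfl, by omega⟩
  · intro c hc c' hc' i hi hon hon'
    have hg := gap_le (I := I) hL hi (j := I.member c) (j' := I.member c')
    rw [hdig _ c hc i hi _ (Nat.zero_le _), hdig _ c hc i hi _ hg,
      hdig _ c' hc' i hi _ (Nat.zero_le _), hdig _ c' hc' i hi _ hg]
    have hsub : ∀ c, ((Finset.range I.n).filter fun j => I.cls j = c ∧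
        u j i + I.gap p (I.member c) (I.member c') i < a + 1) ⊆
        (Finset.range I.n).filter fun j => I.cls j = c ∧ u j i + 0 < a + 1 := by
      intro c j hj
      simp only [Finset.mem_filter] at hj ⊢
      exact ⟨hj.1, hj.2.1, by omega⟩
    -- A count that has grown during the last `g` slots yields a job started in them.
    have hocc : ∀ b g, ((Finset.range I.n).filter fun j => I.cls j = b ∧ u j i + g < a + 1).card <
        ((Finset.range I.n).filter fun j => I.cls j = b ∧ u j i + 0 < a + 1).card →
        ∃ j < I.n, I.cls j = b ∧ u j i < a + 1 ∧ ¬ u j i + g < a + 1 := by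
      intro b g hcard
      by_contra hno
      push Not at hno
      refine absurd hcard (not_lt.2 (Finset.card_le_card fun j hj => ?_))
      simp only [Finset.mem_filter, Finset.mem_range] at hj ⊢
      exact ⟨hj.1, hj.2.1, hno j hj.1 hj.2.1 hj.2.2⟩
    have hconf : ∀ j < I.n, ∀ j' < I.n, j ≠ j' → I.cls j = c → I.cls j' = c' →
        u j i < a + 1 → u j' i < a + 1 →
        ¬ u j i + I.gap p (I.member c) (I.member c') i < a + 1 →
        ¬ u j' i + I.gap p (I.member c) (I.member c') i < a + 1 → False := by
      rintro j hj j' hj' hne rfl rfl h1 h2 h3 h4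
      rw [(hsame j hj).gap (hsame j' hj') hi hj (member_spec hj').1] at h3 h4
      have := hu.conflict j hj j' hj' hne i (((hsame j hj).onPath i).1 hon)
        (((hsame j' hj').onPath i).1 hon')
      omega
    constructor
    · intro hne
      by_contra hno
      push Not at hno
      obtain ⟨j, hj, hcj, h1, h2⟩ := hocc c _ hno.1
      obtain ⟨j', hj', hcj', h1', h2'⟩ := hocc c' _ hno.2
      exact hconf j hj j' hj' (fun e => hne (hcj.symm.trans ((congrArg I.cls e).trans hcj')))
        hcj hcj' h1 h1' h2 h2'
    · rintro rfl
      by_contra hno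
      push Not at hno
      -- Within one class the count has grown by at least two, which yields two different jobs.
      have hd := Finset.card_sdiff_add_card_eq_card (hsub c)
      obtain ⟨j, hj, j', hj', hne⟩ := Finset.one_lt_card.1 (show 1 <
        (((Finset.range I.n).filter fun j => I.cls j = c ∧ u j i + 0 < a + 1) \
          ((Finset.range I.n).filter fun j => I.cls j = c ∧
            u j i + I.gap p (I.member c) (I.member c) i < a + 1)).card by omega)
      simp only [Finset.mem_sdiff, Finset.mem_filter, Finset.mem_range] at hj hj'
      exact hconf j hj.1.1 j' hj'.1.1 hne hj.1.2.1 hj'.1.2.1 hj.1.2.2 hj'.1.2.2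
        (fun h => hj.2 ⟨hj.1.1, hj.1.2.1, h⟩) (fun h => hj'.2 ⟨hj'.1.1, hj'.1.2.1, h⟩)
  · intro c hc i hi hon
    rw [hdig _ c hc i hi _ (Nat.zero_le _), classSize]
    congr 1
    refine Finset.filter_congr fun j hj => ?_
    rw [Finset.mem_range] at hj
    refine ⟨fun h => h.1, ?_⟩
    rintro rfl
    exact ⟨rfl, hlt j hj i (((hsame j hj).onPath i).1 hon)⟩
  · refine sum_stepCost hκ (fun j hj => hlt j hj _ (onPath_tg j)) ?_ ?_
    · intro c hc a _
      rw [hdig _ c hc _ (seg_lt hc).2 _ (Nat.zero_le _)]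
      congr 1
      refine Finset.filter_congr fun j hj => and_congr_right ?_
      rintro rfl
      rw [(hsame j (Finset.mem_range.1 hj)).2.2.1, add_zero]
    · intro c hc a _
      rw [hdig _ c hc _ (seg_lt hc).2 _ (Nat.zero_le _), hdig _ c hc _ (seg_lt hc).2 _ hL1]
      congr 1
      refine Finset.filter_congr fun j _ => and_congr_right fun _ => ?_
      omega

/-! ### From sequences of states to timetables -/

/-- By monotonicity the set is an initial segment, so its cardinality is the first `b < S` with `r <
f (b + 1)`, if there is one: the slot in which the job of rank `r` starts when `f` counts the
started jobs. -/
theorem card_le_lt_iff {f : ℕ → ℕ} {S r a : ℕ} (h0 : f 0 = 0)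
    (hf : ∀ a b, a ≤ b → b ≤ S → f a ≤ f b) (ha : a ≤ S) :
    ((Finset.range S).filter fun b => f (b + 1) ≤ r).card < a ↔ r < f a := by
  constructor
  · intro h
    by_contra hle
    refine absurd h (not_lt.2 ?_)
    calc a = (Finset.range a).card := (Finset.card_range a).symm
      _ ≤ _ := Finset.card_le_card fun b hb => ?_
    simp only [Finset.mem_filter, Finset.mem_range] at hb ⊢
    exact ⟨by omega, (hf _ _ hb ha).trans (not_lt.1 hle)⟩
  · intro h
    have ha0 : a ≠ 0 := by rintro rfl; omega
    have hsub : ((Finset.range S).filter fun b => f (b + 1) ≤ r) ⊆ Finset.range (a - 1) := by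
      intro b hb
      simp only [Finset.mem_filter, Finset.mem_range] at hb ⊢
      by_contra hlt
      have := hf a (b + 1) (by omega) hb.1
      omega
    have := Finset.card_le_card hsub
    rw [Finset.card_range] at this
    omega

-- The exchange argument. A job of rank `r` starts on a segment in the slot where the count of its
-- class first exceeds `r`. As the order is the same on all segments, inequalities between counts
-- become inequalities between the start times of each job, while the cost depends on the counts
-- only.
open Classical in
theorem timetable_of_states (hκ : I.numTypes ≤ κ) (hL1 : 1 ≤ L) (hL : ∀ i < I.m, p + I.tr i ≤ L)
    {z : ℕ → ℕ} (h0 : z 0 = 0) (hv : ∀ a < I.slots L, I.Valid κ p L a (z a) (z (a + 1)))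
    (hf : I.Final κ L (z (I.slots L))) {u : ℕ → ℕ → ℕ}
    (hu : ∀ j i, u j i = ((Finset.range (I.slots L)).filter fun a =>
      I.digit κ L (z (a + 1)) (I.cls j) i 0 ≤ I.rank j).card) :
    I.Timetable p (I.slot L) u ∧ (∀ j < I.n, ∀ i, I.OnPath j i → u j i < I.slots L) ∧
      ∑ a ∈ Finset.range (I.slots L), I.stepCost κ L a (z (a + 1)) =
        ∑ j ∈ Finset.range I.n, I.slot L (u j (I.tg j)) := by
  have hsame : ∀ j < I.n, I.Same (I.member (I.cls j)) j := fun j hj => (member_spec hj).2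
  -- For `a < k` the truncated difference leads to state `0`, in which nothing has been started.
  have hshift : ∀ c < I.classBound κ, ∀ i < I.m, ∀ k ≤ L, ∀ a ≤ I.slots L,
      I.digit κ L (z a) c i k = I.digit κ L (z (a - k)) c i 0 := by
    intro c hc i hi k
    induction k with
    | zero => intros; rfl
    | succ k ih =>
      intro hk a ha
      cases a with
      | zero => rw [Nat.zero_sub, h0, digit_zero, digit_zero]
      | succ a =>
        rw [((hv a ha).1 c hc i hi).1 k hk, ih (by omega) a (by omega), Nat.add_sub_add_right]
  have hmono : ∀ c < I.classBound κ, ∀ i < I.m, ∀ a b, a ≤ b → b ≤ I.slots L →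
      I.digit κ L (z a) c i 0 ≤ I.digit κ L (z b) c i 0 := by
    intro c hc i hi a b hab
    induction b, hab using Nat.le_induction with
    | base => exact fun _ => le_rfl
    | succ b _ ih => exact fun hb => (ih (by omega)).trans ((hv b hb).1 c hc i hi).2
  have hkey : ∀ j < I.n, ∀ i < I.m, ∀ a ≤ I.slots L,
      u j i < a ↔ I.rank j < I.digit κ L (z a) (I.cls j) i 0 := by
    intro j hj i hi a ha
    rw [hu]
    exact card_le_lt_iff (f := fun a => I.digit κ L (z a) (I.cls j) i 0)
      (by rw [h0, digit_zero]) (hmono _ (cls_lt hκ hj) i hi) ha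
  have hlt : ∀ j < I.n, ∀ i, I.OnPath j i → u j i < I.slots L := by
    intro j hj i hon
    have hi := hon.lt hj
    rw [hkey j hj i hi _ le_rfl, hf _ (cls_lt hκ hj) i hi (((hsame j hj).onPath i).2 hon)]
    exact rank_lt_classSize hj
  refine ⟨⟨?_, ?_, ?_⟩, hlt, ?_⟩
  · intro j hj
    have hlt' := hlt j hj _ (onPath_st j)
    have h1 := (hkey j hj _ (st_lt hj) _ hlt').1 (Nat.lt_succ_self _)
    have h2 := (hv _ hlt').2.1 _ (cls_lt hκ hj)
    rw [(hsame j hj).2.1] at h2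
    exact rel_le_of_rank_lt (h1.trans_le h2)
  · intro j hj i i' hfo
    have hi := hfo.1.lt hj
    have hi' := hfo.2.1.lt hj
    have hlt' := hlt j hj _ hfo.2.1
    have h1 := (hkey j hj _ hi' _ hlt').1 (Nat.lt_succ_self _)
    have h2 := (hv _ hlt').2.2.1 _ (cls_lt hκ hj) i hi i' hi' (((hsame j hj).follows i i').2 hfo)
    rw [hshift _ (cls_lt hκ hj) i hi _ (hL i hi) _ hlt'] at h2
    have := (hkey j hj i hi _ ((Nat.sub_le _ _).trans hlt')).2 (h1.trans_le h2)
    omega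
  · have main : ∀ j < I.n, ∀ j' < I.n, j ≠ j' → ∀ i, I.OnPath j i → I.OnPath j' i →
        u j i ≤ u j' i → u j i + I.gap p j j' i ≤ u j' i := by
      intro j hj j' hj' hne i hon hon' hle
      have hi := hon.lt hj
      have hlt' : u j' i + 1 ≤ I.slots L := hlt j' hj' i hon'
      -- Otherwise both jobs start among the last `gap` slots up to `u j' i`. This contradicts
      -- validity, in the case of one class because the two ranks differ.
      by_contra hgap
      have h1 := (hkey j' hj' i hi _ hlt').1 (Nat.lt_succ_self _)
      have h2 := (hkey j hj i hi (u j' i + 1) hlt').1 (by omega)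
      have hgL := gap_le hL hi (j := j) (j' := j')
      have h3 := (hkey j' hj' i hi (u j' i + 1 - I.gap p j j' i) (by omega)).not.1 (by omega)
      have h4 := (hkey j hj i hi (u j' i + 1 - I.gap p j j' i) (by omega)).not.1 (by omega)
      rw [← hshift _ (cls_lt hκ hj') i hi _ hgL _ hlt'] at h3
      rw [← hshift _ (cls_lt hκ hj) i hi _ hgL _ hlt'] at h4
      have h5 := (hv _ hlt').2.2.2 _ (cls_lt hκ hj) _ (cls_lt hκ hj') i hi
        (((hsame j hj).onPath i).2 hon) (((hsame j' hj').onPath i).2 hon')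
      rw [(hsame j hj).gap (hsame j' hj') hi hj (member_spec hj').1] at h5
      by_cases hc : I.cls j = I.cls j'
      · have h6 := h5.2 hc
        have h7 := rank_ne_rank hj hj' hc hne
        rw [← hc] at h1 h3
        omega
      · have h6 := h5.1 hc
        omega
    intro j hj j' hj' hne i hon hon'
    rcases le_total (u j i) (u j' i) with h | h
    · exact Or.inl (main j hj j' hj' hne i hon hon' h)
    · rw [gap_comm]
      exact Or.inr (main j' hj' j hj hne.symm i hon' hon h)
  · refine sum_stepCost hκ (fun j hj => hlt j hj _ (onPath_tg j)) ?_ ?_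
    · intro c hc a ha
      have hle : I.digit κ L (z a) c (I.tg (I.member c)) 0 ≤ I.classSize c := by
        rw [← hf _ hc _ (seg_lt hc).2 (onPath_tg _)]
        exact hmono _ hc _ (seg_lt hc).2 _ _ ha le_rfl
      refine (card_rank_lt c hle).symm.trans ?_
      congr 1
      refine Finset.filter_congr fun j hj => and_congr_right ?_
      rintro rfl
      rw [Finset.mem_range] at hj
      rw [(hsame j hj).2.2.1]
      exact (hkey j hj _ (tg_lt hj) a ha).symm
    · intro c hc a ha
      rw [hshift c hc _ (seg_lt hc).2 1 hL1 (a + 1) ha, Nat.add_sub_cancel]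

/-! ### Optimal sequences of states -/

theorem value_le {z : ℕ → ℕ} (hz : ∀ a, z a < I.states κ L) {r : ℕ} (hr : r ≤ I.slots L) :
    I.value κ p L r (z (I.slots L - r)) ≤
      ∑ a ∈ Finset.Ico (I.slots L - r) (I.slots L), I.weight κ p L a (z a) (z (a + 1)) +
        I.finalWeight κ L (z (I.slots L)) := by
  induction r with
  | zero => simp [value]
  | succ r ih =>
    have h1 : I.slots L - (r + 1) + 1 = I.slots L - r := by omega
    rw [Finset.sum_eq_sum_Ico_succ_bot (by omega), h1, add_assoc, value]
    refine (minN_le _ (hz (I.slots L - r))).trans ?_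
    exact Nat.add_le_add_left (ih (by omega)) _

theorem pathState_succ {q : ℕ} (hq : q < I.slots L) : I.pathState κ p L (q + 1) =
    findN (fun y => I.weight κ p L q (I.pathState κ p L q) y +
      I.value κ p L (I.slots L - (q + 1)) y =
        I.value κ p L (I.slots L - q) (I.pathState κ p L q)) (I.states κ L) := by
  rw [pathState, min_eq_left (by omega), iterN]
  rw [pathState, min_eq_left (by omega)]

theorem pathState_zero : I.pathState κ p L 0 = 0 := by
  rw [pathState, Nat.zero_min]; rfl

theorem value_pathState {q : ℕ} (hq : q < I.slots L) :
    I.weight κ p L q (I.pathState κ p L q) (I.pathState κ p L (q + 1)) +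
      I.value κ p L (I.slots L - (q + 1)) (I.pathState κ p L (q + 1)) =
        I.value κ p L (I.slots L - q) (I.pathState κ p L q) := by
  have hspec := findN_spec (b := I.states κ L) (p := fun y =>
    I.weight κ p L q (I.pathState κ p L q) y + I.value κ p L (I.slots L - (q + 1)) y =
        I.value κ p L (I.slots L - q) (I.pathState κ p L q)) (by
    have h1 : I.slots L - q = I.slots L - (q + 1) + 1 := by omega
    have h2 : I.slots L - (I.slots L - (q + 1) + 1) = q := by omega
    rw [h1, value, h2]
    obtain ⟨y, hy, he⟩ := exists_minN_eq (fun y => I.weight κ p L q (I.pathState κ p L q) y +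
      I.value κ p L (I.slots L - (q + 1)) y) (I.states_pos κ L)
    exact ⟨y, hy, he.symm⟩)
  rw [pathState_succ hq]
  exact hspec.2

theorem sum_weight_pathState :
    ∑ a ∈ Finset.range (I.slots L),
      I.weight κ p L a (I.pathState κ p L a) (I.pathState κ p L (a + 1)) +
        I.finalWeight κ L (I.pathState κ p L (I.slots L)) = I.value κ p L (I.slots L) 0 := by
  have key : ∀ q ≤ I.slots L, ∑ a ∈ Finset.range q,
      I.weight κ p L a (I.pathState κ p L a) (I.pathState κ p L (a + 1)) +
        I.value κ p L (I.slots L - q) (I.pathState κ p L q) = I.value κ p L (I.slots L) 0 := by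
    intro q
    induction q with
    | zero => intro _; simp [pathState_zero]
    | succ q ih =>
      intro hq
      rw [Finset.sum_range_succ, add_assoc, value_pathState hq, ih (by omega)]
  have := key _ le_rfl
  rwa [Nat.sub_self, value] at this

/-- If some sequence of states costs less than the penalty, the computed one is a sequence of
least cost. -/
theorem pathState_optimal {z : ℕ → ℕ} (hz : ∀ a, z a < I.states κ L) (h0 : z 0 = 0)
    (hv : ∀ a < I.slots L, I.Valid κ p L a (z a) (z (a + 1))) (hf : I.Final κ L (z (I.slots L)))
    (hbig : ∑ a ∈ Finset.range (I.slots L), I.stepCost κ L a (z (a + 1)) < I.big L) :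
    (∀ a < I.slots L, I.Valid κ p L a (I.pathState κ p L a) (I.pathState κ p L (a + 1))) ∧
      I.Final κ L (I.pathState κ p L (I.slots L)) ∧
      ∑ a ∈ Finset.range (I.slots L), I.stepCost κ L a (I.pathState κ p L (a + 1)) ≤
        ∑ a ∈ Finset.range (I.slots L), I.stepCost κ L a (z (a + 1)) := by
  classical
  have hle := value_le (p := p) hz le_rfl
  rw [Nat.sub_self, h0, ← sum_weight_pathState, Nat.Ico_zero_eq_range,
    show I.finalWeight κ L (z (I.slots L)) = 0 from if_pos hf, add_zero,
    Finset.sum_congr rfl fun a ha => show I.weight κ p L a (z a) (z (a + 1)) =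
      I.stepCost κ L a (z (a + 1)) from if_pos (hv a (Finset.mem_range.1 ha))] at hle
  -- A single penalty would already exceed the cost of `z`; the same holds for `hval`.
  have hfin : I.Final κ L (I.pathState κ p L (I.slots L)) := by
    by_contra hno
    rw [show I.finalWeight κ L (I.pathState κ p L (I.slots L)) = I.big L from if_neg hno] at hle
    omega
  have hval : ∀ a < I.slots L,
      I.Valid κ p L a (I.pathState κ p L a) (I.pathState κ p L (a + 1)) := by
    intro a ha
    by_contra hno
    have h1 := Finset.single_le_sum (s := Finset.range (I.slots L))
      (f := fun a => I.weight κ p L a (I.pathState κ p L a) (I.pathState κ p L (a + 1)))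
      (fun _ _ => Nat.zero_le _) (Finset.mem_range.2 ha)
    have h2 : I.weight κ p L a (I.pathState κ p L a) (I.pathState κ p L (a + 1)) = I.big L :=
      if_neg hno
    simp only [h2] at h1
    omega
  refine ⟨hval, hfin, le_trans (le_of_eq ?_) (le_trans (Nat.le_add_right _ _) hle)⟩
  exact Finset.sum_congr rfl fun a ha => (if_pos (hval a (Finset.mem_range.1 ha))).symm

theorem st_le_tg {j : ℕ} (h : I.rt j) : I.st j ≤ I.tg j := by
  obtain ⟨hj, hr⟩ := h
  simpa [st, tg, hj] using I.start_le_target _ hr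

theorem tg_le_st {j : ℕ} (hj : j < I.n) (h : ¬ I.rt j) : I.tg j ≤ I.st j := by
  have : I.right ⟨j, hj⟩ = false := by simpa [rt, hj] using h
  simpa [st, tg, hj] using I.target_le_start _ this

/-- Every segment of a path but the first has a predecessor. -/
theorem exists_follows {j i : ℕ} (hj : j < I.n) (hon : I.OnPath j i) (hne : i ≠ I.st j) :
    ∃ i₀, I.Follows j i₀ i ∧ (i₀ - I.st j) + (I.st j - i₀) + 1 = (i - I.st j) + (I.st j - i) := by
  by_cases h : I.rt j
  · have := st_le_tg h
    unfold OnPath at hon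
    refine ⟨i - 1, ⟨?_, ?_, Or.inl ⟨h, by omega⟩⟩, by omega⟩ <;> unfold OnPath <;> omega
  · have := tg_le_st hj h
    unfold OnPath at hon
    refine ⟨i + 1, ⟨?_, ?_, Or.inr ⟨h, by omega⟩⟩, by omega⟩ <;> unfold OnPath <;> omega

theorem Follows.dist {j i i' : ℕ} (hj : j < I.n) (h : I.Follows j i i') :
    (i' - I.st j) + (I.st j - i') = (i - I.st j) + (I.st j - i) + 1 := by
  obtain ⟨h1, h2, ⟨hr, rfl⟩ | ⟨hr, rfl⟩⟩ := h
  · have := st_le_tg hr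
    unfold OnPath at h1 h2
    omega
  · have := tg_le_st hj hr
    unfold OnPath at h1 h2
    omega

/-! ### Existence and normal form of timetables -/

/-- Running the jobs one after the other. -/
theorem exists_timetable (hL : ∀ i < I.m, p + I.tr i ≤ L) : ∃ u, I.Timetable p id u := by
  -- The sum of the release dates is at least each of them; thereafter every job has a block of `m *
  -- L` time units to itself.
  refine ⟨fun j i => ∑ k ∈ Finset.range I.n, I.rel k + j * (I.m * L) +
    ((i - I.st j) + (I.st j - i)) * L, fun j hj => ?_, fun j hj i i' hf => ?_,
    fun j hj j' hj' hne i hon hon' => ?_⟩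
  · have := Finset.single_le_sum (f := I.rel) (fun _ _ => Nat.zero_le _) (Finset.mem_range.2 hj)
    exact (this.trans (Nat.le_add_right _ _)).trans (Nat.le_add_right _ _)
  · have := hL i (hf.1.lt hj)
    rw [hf.dist hj, Nat.succ_mul]
    omega
  · have key : ∀ j < I.n, ∀ j' < I.n, ∀ g ≤ L, j < j' → I.OnPath j i →
        j * (I.m * L) + ((i - I.st j) + (I.st j - i)) * L + g ≤ j' * (I.m * L) := by
      intro j hj j' _ g hg hlt hon
      have h1 := Nat.mul_le_mul_right (I.m * L) hlt
      have h2 := st_lt hj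
      have h3 := hon.lt hj
      have h4 := Nat.mul_le_mul_right L (show (i - I.st j) + (I.st j - i) + 1 ≤ I.m by omega)
      rw [Nat.succ_mul] at h1 h4
      omega
    have hg := gap_le hL (hon.lt hj) (j := j) (j' := j')
    rcases lt_or_gt_of_ne hne with hlt | hlt
    · have := key j hj j' hj' _ hg hlt hon
      left; omega
    · have := key j' hj' j hj _ hg hlt hon'
      right; omega

/-- Every start time is a release date or follows another start time closely. -/
def Tight (I : Instance) (L : ℕ) (u : ℕ → ℕ → ℕ) : Prop :=
  ∀ j < I.n, ∀ i, I.OnPath j i → (∃ j' < I.n, u j i = I.rel j') ∨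
    ∃ j' < I.n, ∃ i', I.OnPath j' i' ∧ ∃ l, 1 ≤ l ∧ l ≤ L ∧ u j i = u j' i' + l

/-- A start time that is not tight can be lowered by one: a constraint broken by this would have
held with equality, making the start time tight. The sum of all start times decreases, so the
process ends. -/
theorem exists_tight (hL : ∀ i < I.m, 1 ≤ p + I.tr i ∧ p + I.tr i ≤ L) {u : ℕ → ℕ → ℕ}
    (hu : I.Timetable p id u) : ∃ v, I.Timetable p id v ∧ I.Tight L v ∧ ∀ j i, v j i ≤ u j i := by
  induction hs : ∑ j ∈ Finset.range I.n, ∑ i ∈ Finset.range I.m, u j i using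
    Nat.strong_induction_on generalizing u with
  | _ s ih =>
  subst hs
  by_cases ht : I.Tight L u
  · exact ⟨u, hu, ht, fun _ _ => le_rfl⟩
  · unfold Tight at ht
    push Not at ht
    obtain ⟨j, hj, i, hon, hrel, hpred⟩ := ht
    have hi := hon.lt hj
    -- A start at time `0` on the first segment equals the release date; on any other segment a
    -- positive crossing time precedes it.
    have hpos : 0 < u j i := by
      by_contra h0
      by_cases hst : i = I.st j
      · have h1 := hu.release j hj
        have h2 := hrel j hj
        rw [← hst] at h1
        simp only [id] at h1
        omega
      · obtain ⟨i₀, hf, -⟩ := exists_follows hj hon hst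
        have := hu.travel j hj _ _ hf
        have := (hL _ (hf.1.lt hj)).1
        omega
    let u' : ℕ → ℕ → ℕ := fun a b => if a = j ∧ b = i then u j i - 1 else u a b
    have hself : u' j i = u j i - 1 := if_pos ⟨rfl, rfl⟩
    have hoth : ∀ a b, ¬ (a = j ∧ b = i) → u' a b = u a b := fun a b h => if_neg h
    have hle : ∀ a b, u' a b ≤ u a b := fun a b => by
      by_cases h : a = j ∧ b = i
      · rw [h.1, h.2, hself]; omega
      · rw [hoth a b h]
    have hu' : I.Timetable p id u' := by
      refine ⟨fun a ha => ?_, fun a ha b b' hf => ?_, fun a ha a' ha' hne b hb hb' => ?_⟩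
      · have h1 := hu.release a ha
        simp only [id] at h1 ⊢
        by_cases h : a = j ∧ I.st a = i
        · obtain ⟨rfl, hsi⟩ := h
          have := hrel a ha
          rw [hsi] at h1 ⊢
          omega
        · rwa [hoth _ _ h]
      · have h1 := hu.travel a ha b b' hf
        by_cases h : a = j ∧ b' = i
        · obtain ⟨rfl, rfl⟩ := h
          have hlen := hL b (hf.1.lt ha)
          have := hpred a ha b hf.1 _ hlen.1 hlen.2
          have := hle a b
          omega
        · rw [hoth _ _ h]
          have := hle a b
          omega
      · have h1 := hu.conflict a ha a' ha' hne b hb hb'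
        have hg := gap_le (fun i hi => (hL i hi).2) (hb.lt ha) (j := a) (j' := a')
        by_cases h : a = j ∧ b = i
        · obtain ⟨rfl, rfl⟩ := h
          rw [hself, hoth a' b (fun h => hne h.1.symm)]
          -- A gap of `0` restricts nothing; `Tight` speaks of distances `l ≥ 1` only, which makes
          -- chains of predecessors strictly decreasing.
          by_cases h0 : I.gap p a a' b = 0
          · omega
          · have := hpred a' ha' b hb' _ (Nat.one_le_iff_ne_zero.2 h0) hg
            omega
        · by_cases h' : a' = j ∧ b = i
          · obtain ⟨rfl, rfl⟩ := h'
            rw [hself, hoth a b h]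
            by_cases h0 : I.gap p a a' b = 0
            · omega
            · have := hpred a ha b hb _ (Nat.one_le_iff_ne_zero.2 h0) hg
              omega
          · rw [hoth _ _ h, hoth _ _ h']
            exact h1
    have hlt : ∑ j ∈ Finset.range I.n, ∑ i ∈ Finset.range I.m, u' j i <
        ∑ j ∈ Finset.range I.n, ∑ i ∈ Finset.range I.m, u j i := by
      refine Finset.sum_lt_sum (fun a _ => Finset.sum_le_sum fun b _ => hle a b)
        ⟨j, Finset.mem_range.2 hj, Finset.sum_lt_sum (fun b _ => hle j b)
          ⟨i, Finset.mem_range.2 hi, ?_⟩⟩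
      rw [hself]; omega
    obtain ⟨v, hv, htv, hvu⟩ := ih _ hlt hu' rfl
    exact ⟨v, hv, htv, fun a b => (hvu a b).trans (hle a b)⟩

/-- Going back from a start time to the one it follows, one meets strictly smaller start times.
After at most `n * m` steps of length at most `L` a release date is reached. -/
theorem Tight.exists_eq_rel_add {u : ℕ → ℕ → ℕ} (hu : I.Tight L u) {j i : ℕ} (hj : j < I.n)
    (hon : I.OnPath j i) : ∃ j' < I.n, ∃ k ≤ I.n * I.m * L, u j i = I.rel j' + k := by
  let before : ℕ → Finset (ℕ × ℕ) := fun t =>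
    (Finset.range I.n ×ˢ Finset.range I.m).filter fun x => u x.1 x.2 < t
  have key : ∀ t, ∀ j < I.n, ∀ i, I.OnPath j i → u j i = t →
      ∃ j' < I.n, ∃ k ≤ (before t).card * L, u j i = I.rel j' + k := by
    intro t
    induction t using Nat.strong_induction_on with
    | _ t ih =>
    intro j hj i hon ht
    rcases hu j hj i hon with ⟨j', hj', h⟩ | ⟨j₁, hj₁, i₁, hon₁, l, hl, hlL, h⟩
    · exact ⟨j', hj', 0, Nat.zero_le _, h⟩
    · obtain ⟨j', hj', k, hk, h'⟩ := ih (u j₁ i₁) (by omega) j₁ hj₁ i₁ hon₁ rfl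
      refine ⟨j', hj', k + l, ?_, by omega⟩
      have hcard : (before (u j₁ i₁)).card < (before t).card := by
        refine Finset.card_lt_card ⟨fun x hx => ?_, fun hsub => ?_⟩
        · simp only [before, Finset.mem_filter] at hx ⊢
          exact ⟨hx.1, by omega⟩
        · have hmem : (j₁, i₁) ∈ before t := by
            simp only [before, Finset.mem_filter, Finset.mem_product, Finset.mem_range]
            exact ⟨⟨hj₁, hon₁.lt hj₁⟩, by omega⟩
          have := hsub hmem
          simp [before] at this
      have := Nat.mul_le_mul_right L hcard
      rw [Nat.succ_mul] at this
      omega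
  obtain ⟨j', hj', k, hk, h⟩ := key _ j hj i hon rfl
  refine ⟨j', hj', k, hk.trans (Nat.mul_le_mul_right L ?_), h⟩
  refine (Finset.card_filter_le _ _).trans ?_
  rw [Finset.card_product, Finset.card_range, Finset.card_range]

/-- Tight timetables use the slots only. -/
theorem exists_slot_timetable (hL : ∀ i < I.m, p + I.tr i ≤ L) {u : ℕ → ℕ → ℕ}
    (hu : I.Timetable p id u) (ht : I.Tight L u) : ∃ v, I.Timetable p (I.slot L) v ∧
      (∀ j < I.n, ∀ i, I.OnPath j i → v j i < I.slots L ∧ I.slot L (v j i) = u j i) := by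
  classical
  -- Times are translated into slots by counting earlier active points; up to distance `L` after a
  -- tight start time the translation preserves distances.
  have hlt : ∀ j < I.n, ∀ i, I.OnPath j i → Nat.count (I.Active L) (u j i) < I.slots L ∧
      I.slot L (Nat.count (I.Active L) (u j i)) = u j i ∧
      ∀ d ≤ L, Nat.count (I.Active L) (u j i) + d = Nat.count (I.Active L) (u j i + d) := by
    intro j hj i hon
    obtain ⟨j', hj', k, hk, h⟩ := ht.exists_eq_rel_add hj hon
    rw [h]
    have h1 := count_rel_add_lt hj' (show k ≤ I.n * I.m * L + L by omega)
    exact ⟨h1, slot_count (active_rel_add hj' (by omega)) h1.le,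
      fun d hd => (count_rel_add_add hj' hk hd).symm⟩
  refine ⟨fun j i => Nat.count (I.Active L) (u j i), ⟨fun j hj => ?_, fun j hj i i' hf => ?_,
    fun j hj j' hj' hne i hon hon' => ?_⟩, fun j hj i hon => ⟨(hlt j hj i hon).1, (hlt j hj i hon).2.1⟩⟩
  · rw [(hlt j hj _ (onPath_st j)).2.1]
    exact hu.release j hj
  · rw [(hlt j hj i hf.1).2.2 _ (hL i (hf.1.lt hj))]
    exact Nat.count_monotone _ (hu.travel j hj i i' hf)
  · have hg := gap_le hL (hon.lt hj) (j := j) (j' := j')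
    rw [(hlt j hj i hon).2.2 _ hg, (hlt j' hj' i hon').2.2 _ hg]
    exact (hu.conflict j hj j' hj' hne i hon hon').imp (fun h => Nat.count_monotone _ h)
      fun h => Nat.count_monotone _ h

/-- Slots are strictly increasing integers, so distances in time are at least the distances in
slots. -/
theorem Timetable.comp_slot {u : ℕ → ℕ → ℕ} (hu : I.Timetable p (I.slot L) u)
    (hlt : ∀ j < I.n, ∀ i, I.OnPath j i → u j i < I.slots L) :
    I.Timetable p id fun j i => I.slot L (u j i) := by
  have key : ∀ a b d, a + d ≤ b → b < I.slots L → I.slot L a + d ≤ I.slot L b :=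
    fun a b d h hb => (add_le_slot_add (by omega)).trans (slot_mono h)
  refine ⟨hu.release, fun j hj i i' hf => key _ _ _ (hu.travel j hj i i' hf) (hlt j hj i' hf.2.1),
    fun j hj j' hj' hne i hon hon' => ?_⟩
  exact (hu.conflict j hj j' hj' hne i hon hon').imp (fun h => key _ _ _ h (hlt j' hj' i hon'))
    fun h => key _ _ _ h (hlt j hj i hon)

/-- The computed start times form an optimal timetable. -/
theorem startSlot_optimal (hκ : I.numTypes ≤ κ) (hL1 : 1 ≤ L)
    (hL : ∀ i < I.m, 1 ≤ p + I.tr i ∧ p + I.tr i ≤ L) :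
    I.Timetable p id (fun j i => I.slot L (I.startSlot κ p L j i)) ∧
      ∀ u, I.Timetable p id u →
        ∑ j ∈ Finset.range I.n, I.slot L (I.startSlot κ p L j (I.tg j)) ≤
          ∑ j ∈ Finset.range I.n, u j (I.tg j) := by
  have hL' : ∀ i < I.m, p + I.tr i ≤ L := fun i hi => (hL i hi).2
  have hstates : ∀ u, I.Timetable p id u → ∃ z : ℕ → ℕ, (∀ a, z a < I.states κ L) ∧ z 0 = 0 ∧
      (∀ a < I.slots L, I.Valid κ p L a (z a) (z (a + 1))) ∧ I.Final κ L (z (I.slots L)) ∧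
      ∑ a ∈ Finset.range (I.slots L), I.stepCost κ L a (z (a + 1)) < I.big L ∧
      ∑ a ∈ Finset.range (I.slots L), I.stepCost κ L a (z (a + 1)) ≤
        ∑ j ∈ Finset.range I.n, u j (I.tg j) := by
    intro u hu
    obtain ⟨v, hv, ht, hvu⟩ := exists_tight hL hu
    obtain ⟨s, hs, hlt⟩ := exists_slot_timetable hL' hv ht
    obtain ⟨z, hz, h0, hval, hfin, hcost⟩ :=
      exists_states_of_timetable hκ hL1 hL' hs fun j hj i hon => (hlt j hj i hon).1
    refine ⟨z, hz, h0, hval, hfin, ?_, ?_⟩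
    · rw [hcost, big, Nat.lt_succ_iff]
      refine (Finset.sum_le_sum (g := fun _ => I.slot L (I.slots L)) fun j hj =>
        slot_mono (hlt j (Finset.mem_range.1 hj) _ (onPath_tg j)).1.le).trans ?_
      rw [Finset.sum_const, Finset.card_range, smul_eq_mul, mul_comm]
    · rw [hcost]
      refine Finset.sum_le_sum fun j hj => ?_
      rw [(hlt j (Finset.mem_range.1 hj) _ (onPath_tg j)).2]
      exact hvu _ _
  -- One timetable is needed to know that some sequence of states avoids the penalty.
  obtain ⟨u₀, hu₀⟩ := exists_timetable hL'
  obtain ⟨z, hz, h0, hval, hfin, hbig, -⟩ := hstates u₀ hu₀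
  obtain ⟨hval', hfin', -⟩ := pathState_optimal hz h0 hval hfin hbig
  obtain ⟨htt, hlt, hcost⟩ := timetable_of_states hκ hL1 hL' pathState_zero hval' hfin'
    (u := I.startSlot κ p L) fun _ _ => rfl
  refine ⟨htt.comp_slot hlt, fun u hu => ?_⟩
  obtain ⟨z, hz, h0, hval, hfin, hbig, hle⟩ := hstates u hu
  rw [← hcost]
  exact (pathState_optimal hz h0 hval hfin hbig).2.2.trans hle

/-! ### Timetables and schedules -/

theorem rel_eq (j : Fin I.n) : I.rel j = I.release j := by simp [rel]

theorem st_eq (j : Fin I.n) : I.st j = I.start j := by simp [st]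

theorem tg_eq (j : Fin I.n) : I.tg j = I.target j := by simp [tg]

theorem rt_iff (j : Fin I.n) : I.rt j ↔ I.right j = true := by simp [rt]

theorem tr_eq (i : Fin I.m) : I.tr i = I.transit i := by simp [tr]

theorem adjN_iff (i : Fin I.m) (j j' : Fin I.n) : I.adjN i j j' ↔ (I.compat i).Adj j j' := by
  simp [adjN]

theorem onPath_iff (j : Fin I.n) (i : Fin I.m) : I.OnPath j i ↔ i ∈ I.segments j := by
  rw [OnPath, st_eq, tg_eq, segments, Set.mem_uIcc]
  rfl

theorem follows_iff (j : Fin I.n) (i i' : Fin I.m) : I.Follows j i i' ↔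
    i ∈ I.segments j ∧ i' ∈ I.segments j ∧ (I.right j = true ∧ (i' : ℕ) = i + 1 ∨
      I.right j = false ∧ (i : ℕ) = i' + 1) := by
  rw [Follows, onPath_iff, onPath_iff, rt_iff, Bool.not_eq_true]

theorem rt_iff_rt (j j' : Fin I.n) : (I.rt j ↔ I.rt j') ↔ I.right j = I.right j' := by
  rw [rt_iff, rt_iff]
  exact Bool.eq_iff_iff.symm

/-- For `l = 0` the intervals are empty and the right side holds because the order is total. That
both lengths agree is due to the common processing time. -/
theorem disjoint_Ico_add_iff (a b : ℝ) (l : ℕ) :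
    Disjoint (Set.Ico a (a + l)) (Set.Ico b (b + l)) ↔ a + l ≤ b ∨ b + l ≤ a := by
  have hl : (0 : ℝ) ≤ l := Nat.cast_nonneg l
  rw [Set.Ico_disjoint_Ico, min_add_add_right]
  rcases le_total a b with h | h
  · rw [min_eq_left h, max_eq_right h]
    exact ⟨Or.inl, fun h' => h'.elim (fun h => h) fun h' => by linarith⟩
  · rw [min_eq_right h, max_eq_left h]
    exact ⟨Or.inr, fun h' => h'.elim (fun h' => by linarith) fun h => h⟩

/-- By induction along the path. In particular start times on the path are nonnegative, as rounding
with `Nat.floor` requires. -/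
theorem Schedule.Feasible.rel_le {S : I.Schedule} (hS : S.Feasible) (j : Fin I.n) (i : Fin I.m)
    (hon : I.OnPath j i) : (I.rel j : ℝ) ≤ S j i := by
  induction hd : (i - I.st j) + (I.st j - i) generalizing i with
  | zero =>
    have : i = I.start j := Fin.ext (by rw [st_eq] at hd; omega)
    rw [this, rel_eq]
    exact hS.release_le j
  | succ d ih =>
    obtain ⟨i₀, hf, hdist⟩ := exists_follows j.2 hon (by omega)
    obtain ⟨i₀, rfl⟩ : ∃ i : Fin I.m, (i : ℕ) = i₀ := ⟨⟨i₀, hf.1.lt j.2⟩, rfl⟩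
    refine (ih i₀ hf.1 (by omega)).trans ?_
    have hle : S.completion j i₀ ≤ S j i := by
      obtain ⟨h1, h2, ⟨h3, h4⟩ | ⟨h3, h4⟩⟩ := (follows_iff j i₀ i).1 hf
      · exact hS.travel_right j h3 _ h1 _ h2 h4
      · exact hS.travel_left j h3 _ h1 _ h2 h4
    refine le_trans ?_ hle
    rw [Schedule.completion, add_assoc]
    exact le_add_of_nonneg_right (by positivity)

/-- Rounding down the start times of a feasible schedule. -/
theorem Schedule.Feasible.exists_timetable (hp : ∀ j, I.proc j = p) {S : I.Schedule}
    (hS : S.Feasible) : ∃ u, I.Timetable p id u ∧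
      ∀ j : Fin I.n, (u j (I.tg j) : ℝ) ≤ S j (I.target j) := by
  classical
  let u : ℕ → ℕ → ℕ := fun j i => if h : j < I.n ∧ i < I.m then ⌊S ⟨j, h.1⟩ ⟨i, h.2⟩⌋₊ else 0
  have hu : ∀ (j : Fin I.n) (i : Fin I.m), u j i = ⌊S j i⌋₊ := fun j i => by simp [u]
  have hpos : ∀ (j : Fin I.n) (i : Fin I.m), I.OnPath j i → 0 ≤ S j i := fun j i hon =>
    (Nat.cast_nonneg _).trans (hS.rel_le j i hon)
  -- Rounding down commutes with adding the natural number `l`, so it preserves every distance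
  -- constraint.
  have hfl : ∀ (a b : ℝ) (l : ℕ), 0 ≤ a → a + l ≤ b → ⌊a⌋₊ + l ≤ ⌊b⌋₊ := fun a b l ha h => by
    rw [← Nat.floor_add_natCast ha]
    exact Nat.floor_mono h
  refine ⟨u, ⟨fun j hj => ?_, fun j hj i i' hf => ?_, fun j hj j' hj' hne i hon hon' => ?_⟩,
    fun j => ?_⟩
  · have := hS.rel_le ⟨j, hj⟩ (I.start ⟨j, hj⟩)
      (by rw [← st_eq]; exact onPath_st _)
    have he := hu ⟨j, hj⟩ (I.start ⟨j, hj⟩)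
    rw [← st_eq] at he
    simp only [id] at he ⊢
    rw [he]
    exact Nat.le_floor this
  · obtain ⟨j, rfl⟩ : ∃ k : Fin I.n, (k : ℕ) = j := ⟨⟨j, hj⟩, rfl⟩
    obtain ⟨i, rfl⟩ : ∃ k : Fin I.m, (k : ℕ) = i := ⟨⟨i, hf.1.lt j.2⟩, rfl⟩
    obtain ⟨i', rfl⟩ : ∃ k : Fin I.m, (k : ℕ) = i' := ⟨⟨i', hf.2.1.lt j.2⟩, rfl⟩
    have hle : S.completion j i ≤ S j i' := by
      obtain ⟨h1, h2, ⟨h3, h4⟩ | ⟨h3, h4⟩⟩ := (follows_iff j i i').1 hf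
      · exact hS.travel_right j h3 _ h1 _ h2 h4
      · exact hS.travel_left j h3 _ h1 _ h2 h4
    rw [hu, hu]
    refine hfl _ _ _ (hpos j i hf.1) ?_
    rw [Schedule.completion, hp] at hle
    rw [tr_eq, Nat.cast_add, ← add_assoc]
    exact hle
  · obtain ⟨i, rfl⟩ : ∃ k : Fin I.m, (k : ℕ) = i := ⟨⟨i, hon.lt hj⟩, rfl⟩
    obtain ⟨j, rfl⟩ : ∃ k : Fin I.n, (k : ℕ) = j := ⟨⟨j, hj⟩, rfl⟩
    obtain ⟨j', rfl⟩ : ∃ k : Fin I.n, (k : ℕ) = j' := ⟨⟨j', hj'⟩, rfl⟩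
    rw [hu, hu]
    have hmem : i ∈ I.segments j ∩ I.segments j' := ⟨(onPath_iff j i).1 hon, (onPath_iff j' i).1 hon'⟩
    have hdis : ∀ l : ℕ, Disjoint (Set.Ico (S j i) (S j i + l)) (Set.Ico (S j' i) (S j' i + l)) →
        ⌊S j i⌋₊ + l ≤ ⌊S j' i⌋₊ ∨ ⌊S j' i⌋₊ + l ≤ ⌊S j i⌋₊ := fun l hl =>
      ((disjoint_Ico_add_iff _ _ _).1 hl).imp (hfl _ _ _ (hpos j i hon)) (hfl _ _ _ (hpos j' i hon'))
    unfold gap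
    split_ifs with h1 h2
    · rw [rt_iff_rt] at h1
      refine hdis p ?_
      have := hS.same_direction j j' (fun e => hne (congrArg Fin.val e)) h1 i hmem
      rwa [hp, hp] at this
    · omega
    · rw [rt_iff_rt] at h1
      rw [adjN_iff] at h2
      refine hdis _ ?_
      have := hS.opposite_direction j j' h1 i hmem h2
      rwa [Schedule.completion, Schedule.completion, hp, hp, add_assoc, add_assoc, ← tr_eq,
        ← Nat.cast_add] at this
  · have he := hu j (I.target j)
    rw [← tg_eq] at he
    rw [he]
    refine Nat.floor_le (hpos _ _ ?_)
    rw [← tg_eq]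
    exact onPath_tg _

theorem Timetable.feasible (hp : ∀ j, I.proc j = p) {u : ℕ → ℕ → ℕ} (hu : I.Timetable p id u)
    {S : I.Schedule} (hS : ∀ j i, S j i = u j i) : S.Feasible := by
  have htravel : ∀ (j : Fin I.n) (i i' : Fin I.m), I.Follows j i i' → S.completion j i ≤ S j i' := by
    intro j i i' hf
    have := hu.travel j j.2 i i' hf
    rw [Schedule.completion, hS, hS, hp, ← tr_eq]
    exact_mod_cast (by omega : u j i + p + I.tr i ≤ u j i')
  have hdis : ∀ (j j' : Fin I.n) (i : Fin I.m), j ≠ j' → i ∈ I.segments j ∩ I.segments j' →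
      Disjoint (Set.Ico (S j i) (S j i + (I.gap p j j' i : ℕ)))
        (Set.Ico (S j' i) (S j' i + (I.gap p j j' i : ℕ))) := by
    intro j j' i hne hmem
    rw [disjoint_Ico_add_iff, hS, hS]
    exact_mod_cast hu.conflict j j.2 j' j'.2 (fun e => hne (Fin.ext e)) i
      ((onPath_iff j i).2 hmem.1) ((onPath_iff j' i).2 hmem.2)
  refine ⟨fun j => ?_, fun j hr i hi i' hi' he => ?_, fun j hr i hi i' hi' he => ?_,
    fun j j' hne hd i hmem => ?_, fun j j' hd i hmem hadj => ?_⟩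
  · rw [hS, ← rel_eq, ← st_eq]
    exact_mod_cast hu.release j j.2
  · exact htravel j i i' ((follows_iff j i i').2 ⟨hi, hi', Or.inl ⟨hr, he⟩⟩)
  · exact htravel j i i' ((follows_iff j i i').2 ⟨hi, hi', Or.inr ⟨hr, he⟩⟩)
  · have := hdis j j' i hne hmem
    rw [gap, if_pos ((rt_iff_rt j j').2 hd)] at this
    rwa [hp, hp]
  · have := hdis j j' i (fun e => hd (congrArg _ e)) hmem
    rw [gap, if_neg (fun h => hd ((rt_iff_rt j j').1 h)), if_neg (fun h => hadj ((adjN_iff i j j').1 h)),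
      tr_eq, Nat.cast_add, ← add_assoc, ← add_assoc] at this
    rwa [Schedule.completion, Schedule.completion, hp, hp]

/-- The output of the algorithm describes an optimal schedule. -/
theorem isOptimal_of_output {m : ℕ} (hI : Restricted m κ p L I) (hL1 : 1 ≤ L) {out : ℕ → ℕ}
    (hout : ∀ k < I.n * I.m, out k = I.output κ p L k) : (I.decodeSchedule out).IsOptimal := by
  obtain ⟨-, hκ, hp, hL⟩ := hI
  have hL' : ∀ i < I.m, 1 ≤ p + I.tr i ∧ p + I.tr i ≤ L := fun i hi => by
    rw [show I.tr i = I.transit ⟨i, hi⟩ from tr_eq ⟨i, hi⟩]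
    exact hL ⟨i, hi⟩
  obtain ⟨hfeas, hopt⟩ := startSlot_optimal hκ hL1 hL'
  have hS : ∀ (j : Fin I.n) (i : Fin I.m),
      I.decodeSchedule out j i = (I.slot L (I.startSlot κ p L j i) : ℕ) := by
    intro j i
    have hlt : (j : ℕ) * I.m + i < I.n * I.m := by
      have := Nat.mul_le_mul_right I.m j.2
      rw [Nat.succ_mul] at this
      omega
    rw [decodeSchedule, hout _ hlt, output, min_eq_left hlt.le, mul_comm, Nat.mul_add_mod,
      Nat.mul_add_div (by omega), Nat.div_eq_of_lt i.2, Nat.mod_eq_of_lt i.2, add_zero]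
  refine ⟨hfeas.feasible hp hS, fun S' hS' => ?_⟩
  obtain ⟨u, hu, hle⟩ := hS'.exists_timetable hp
  have hcost := hopt u hu
  rw [Finset.sum_range, Finset.sum_range] at hcost
  have hcost' : ∑ j : Fin I.n, I.decodeSchedule out j (I.target j) ≤
      ∑ j : Fin I.n, S' j (I.target j) := by
    refine le_trans ?_ (Finset.sum_le_sum fun j _ => hle j)
    rw [Finset.sum_congr rfl fun j _ => hS j (I.target j)]
    simp only [tg_eq] at hcost ⊢
    exact_mod_cast hcost
  -- Processing and transit times contribute the same constant to both totals.
  simp only [Schedule.totalCompletion, Schedule.completion, Finset.sum_add_distrib]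
  linarith

end Instance

theorem PolyTimeOn.mono {P Q : Instance → Prop} (h : PolyTimeOn Q) (hPQ : ∀ I, P I → Q I) :
    PolyTimeOn P := by
  obtain ⟨c, q, hc⟩ := h
  exact ⟨c, q, fun I hI => hc I (hPQ I hI)⟩

end BidirScheduling

theorem theorem6 (m κ T : ℕ) :
    BidirScheduling.PolyTimeOn (fun I => I.m = m ∧ I.numTypes ≤ κ ∧
      (∀ j, I.proc j = 1) ∧ (∀ i, I.transit i ≤ T)) ∧
    BidirScheduling.PolyTimeOn (fun I => I.m = m ∧ I.numTypes ≤ κ ∧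
      (∀ j, I.proc j = 0) ∧ (∀ i, I.transit i = 1)) := by
  constructor
  · refine (BidirScheduling.polyTimeOn_restricted m κ 1 (T + 1) fun I hI out hout =>
      BidirScheduling.Instance.isOptimal_of_output hI (by omega) hout).mono ?_
    rintro I ⟨hm, hκ, hp, hT⟩
    exact ⟨hm, hκ, hp, fun i => ⟨by omega, by have := hT i; omega⟩⟩
  · refine (BidirScheduling.polyTimeOn_restricted m κ 0 1 fun I hI out hout =>
      BidirScheduling.Instance.isOptimal_of_output hI (by omega) hout).mono ?_
    rintro I ⟨hm, hκ, hp, hT⟩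
    exact ⟨hm, hκ, hp, fun i => by have := hT i; omega⟩
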